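/- **Model.** For every $T\in\mathbb N$ let $X_t=f_t+\epsilon_t$, $t=1,\dots,T$, where $f=f^{(T)}$ is a deterministic signal, which may depend on $T$, and $\epsilon_1,\dots,\epsilon_T$ are independent $N(0,1)$ variables. Let $\eta_1<\dots<\eta_N$ be the change points of $f$, i.e. the $t\in\{1,\dots,T-1\}$ with $f_t\ne f_{t+1}$, and put $\eta_0=0$, $\eta_{N+1}=T$, $\delta_i=|f_{\eta_i+1}-f_{\eta_i}|$ and $\lambda=\min_{0\le i\le N}(\eta_{i+1}-\eta_i)$. **Seeded intervals.** Let $a\in[1/2,1)$ and let $m\ge 2$ be an integer. For $1\le k\le\lceil\log_{1/a}T\rceil$ put $n_k=2\lceil a^{-(k-1)}\rceil-1$, $l_k=Ta^{k-1}$, $s_k=(T-l_k)/(n_k-1)$ (for $k=1$, where $n_1=1$, put $s_1=0$). Let $\mathcal I$ be the collection of those intervals $(\lfloor (i-1)s_k\rfloor,\lceil (i-1)s_k+l_k\rceil]$, $1\le i\le n_k$, $1\le k\le\lceil\log_{1/a}T\rceil$, that contain at least $m$ integers. **Selection.** For integers $\ell<s<r$ let $$T_{(\ell,r]}(s)=\sqrt{\tfrac{r-s}{(r-\ell)(s-\ell)}}\sum_{t=\ell+1}^sX_t-\sqrt{\tfrac{s-\ell}{(r-\ell)(r-s)}}\sum_{t=s+1}^rX_t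 ,$$ let $\hat s_{(\ell,r]}$ be a maximiser of $|T_{(\ell,r]}(s)|$ over $\ell<s<r$, and call the maximum the gain of $(\ell,r]$. Narrowest-over-threshold selection with threshold $\kappa\ge0$ repeats the following until no interval with gain $>\kappa$ is left in $\mathcal I$: take a shortest interval $(\ell,r]$ among the remaining ones with gain $>\kappa$, add $\hat s_{(\ell,r]}$ to the set of estimates, and remove all intervals containing $\hat s_{(\ell,r]}$. Ties are broken arbitrarily. Let $S(\kappa)$ be the resulting set. For $S\subseteq\{1,\dots,T-1\}$ let $\mathrm{RSS}(S)$ be the residual sum of squares of the fit to $X_1,\dots,X_T$ by segment means with change points $S$, and for $\theta>1$ let $$\mathrm{sSIC}_\theta(S)=\mathrm{RSS}(S)+\gamma\,|S|\,(\log T)^{\theta}$$ be the strengthened Schwarz information criterion, where $\gamma>0$ is a fixed constant ($\gamma=2$ if a location and a level are counted for each change point). The final estimates $\hat\eta_1<\dots<\hat\eta_{\hat N}$ are the elements of $S(\hat\kappa)$, where $\hat\kappa$ minimises $\mathrm{sSIC}_\theta(S(\kappa))$ over $\kappa\ge0$. **Theorem.** Let $1<\theta<\theta_0$, $\gamma>0$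 and $0<c_1<c_2<\infty$. There is a constant $C$, independent of $T$, of $a$, of $m$ and of the signals, such that the following holds for all $a\in[1/2,1)$, all $m\ge2$ and all sequences of signals $f=f^{(T)}$ that satisfy, for all sufficiently large $T$, $\lambda\ge(\log T)^{\theta_0}$, $N\in(c_1,c_2)$ and $\delta_j\in(c_1,c_2)$ for $j=1,\dots,N$: as $T\to\infty$, $$\Pr\Big\{\hat N=N,\ \max_{i=1,\dots,N}\delta_i^2|\hat\eta_i-\eta_i|\le C\log T\Big\}\to1 .$$ -/

import Mathlib

open MeasureTheory ProbabilityTheory Filter Topology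

namespace SeedBS

noncomputable section

/-- The change points of the signal `f 1, …, f T`: the indices `t ∈ {1, …, T - 1}` with
`f t ≠ f (t + 1)`. -/
def changePoints (T : ℕ) (f : ℕ → ℝ) : Finset ℕ :=
  (Finset.Ico 1 T).filter fun t => f t ≠ f (t + 1)

/-- The size `|f (t + 1) - f t|` of the jump of `f` at `t`. -/
def jump (f : ℕ → ℝ) (t : ℕ) : ℝ := |f (t + 1) - f t|

/-- The pairs `(u, v)` of consecutive elements of `{0} ∪ S ∪ {T}`, for `S ⊆ {1, …, T - 1}`; such a
pair stands for the segment `(u, v]`. -/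
def segments (T : ℕ) (S : Finset ℕ) : Finset (ℕ × ℕ) :=
  (insert 0 (insert T S) ×ˢ insert 0 (insert T S)).filter fun p =>
    p.1 < p.2 ∧ ∀ s ∈ S, ¬(p.1 < s ∧ s < p.2)

/-- The minimal distance between consecutive elements of `{0} ∪ S ∪ {T}`. -/
def minSpacing (T : ℕ) (S : Finset ℕ) : ℕ :=
  sInf {d | ∃ p ∈ segments T S, d = p.2 - p.1}

/-- The observations `X 1, …, X T` have means `f 1, …, f T` and independent standard Gaussian
errors. -/
structure IsGaussianModel {Ω : Type*} [MeasurableSpace Ω] (P : Measure Ω) (T : ℕ) (f : ℕ → ℝ)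
    (X : ℕ → Ω → ℝ) : Prop where
  law : ∀ t ∈ Finset.Icc 1 T, HasLaw (fun ω => X t ω - f t) (gaussianReal 0 1) P
  indep : iIndepFun (fun (t : Finset.Icc 1 T) ω => X t ω - f t) P

/-! ### Seeded intervals. A pair `(ℓ, r)` stands for the integer interval `(ℓ, r]`. -/

/-- The number of intervals in the `k`-th layer. -/
def layerCount (a : ℝ) (k : ℕ) : ℕ := 2 * ⌈(1 / a) ^ (k - 1)⌉₊ - 1

/-- The initial length of the intervals in the `k`-th layer. -/
def layerLength (a : ℝ) (T k : ℕ) : ℝ := T * a ^ (k - 1)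

/-- The shift between the intervals in the `k`-th layer; for `k = 1`, where there is a single
interval, the value is `0 / 0 = 0` and plays no role. -/
def layerShift (a : ℝ) (T k : ℕ) : ℝ := (T - layerLength a T k) / ((layerCount a k : ℝ) - 1)

/-- The `k`-th layer of seeded intervals. -/
def layer (a : ℝ) (T k : ℕ) : Finset (ℕ × ℕ) :=
  (Finset.Icc 1 (layerCount a k)).image fun i : ℕ =>
    (⌊((i : ℝ) - 1) * layerShift a T k⌋₊,
      ⌈((i : ℝ) - 1) * layerShift a T k + layerLength a T k⌉₊)

/-- The seeded intervals with decay `a` that contain at least `m` observations. -/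
def seededIntervals (a : ℝ) (m T : ℕ) : Finset (ℕ × ℕ) :=
  ((Finset.Icc 1 ⌈Real.logb (1 / a) T⌉₊).biUnion fun k => layer a T k).filter fun I =>
    m ≤ I.2 - I.1

/-! ### CUSUM statistics and narrowest-over-threshold selection -/

/-- The CUSUM statistic of the data `x` at the split point `s` of the interval `(ℓ, r]`,
`ℓ < s < r`. -/
def cusum (x : ℕ → ℝ) (I : ℕ × ℕ) (s : ℕ) : ℝ :=
  √(((I.2 : ℝ) - s) / (((I.2 : ℝ) - I.1) * ((s : ℝ) - I.1))) * ∑ t ∈ Finset.Ioc I.1 s, x t -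
    √(((s : ℝ) - I.1) / (((I.2 : ℝ) - I.1) * ((I.2 : ℝ) - s))) * ∑ t ∈ Finset.Ioc s I.2, x t

/-- `s` maximises the absolute CUSUM statistic over the split points of the interval `I`. -/
def IsBestSplit (x : ℕ → ℝ) (I : ℕ × ℕ) (s : ℕ) : Prop :=
  s ∈ Finset.Ioo I.1 I.2 ∧ ∀ s' ∈ Finset.Ioo I.1 I.2, |cusum x I s'| ≤ |cusum x I s|

/-- The maximal absolute CUSUM statistic on the interval `I` exceeds `κ`. -/
def OverThreshold (x : ℕ → ℝ) (κ : ℝ) (I : ℕ × ℕ) : Prop :=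
  ∃ s, IsBestSplit x I s ∧ κ < |cusum x I s|

/-- `NOTSelects x κ J S`: narrowest-over-threshold selection with threshold `κ`, started with the
collection `J` of intervals, can return the set `S` of change point estimates. All ways to break
ties (between equally short intervals, or between several best split points) are allowed. -/
inductive NOTSelects (x : ℕ → ℝ) (κ : ℝ) : Finset (ℕ × ℕ) → Finset ℕ → Prop
  | done {J : Finset (ℕ × ℕ)} (none_over : ∀ I ∈ J, ¬OverThreshold x κ I) : NOTSelects x κ J ∅
  | step {J : Finset (ℕ × ℕ)} {S : Finset ℕ} {I : ℕ × ℕ} {s : ℕ} (mem : I ∈ J)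
      (is_over : OverThreshold x κ I)
      (narrowest : ∀ I' ∈ J, OverThreshold x κ I' → I.2 - I.1 ≤ I'.2 - I'.1)
      (best : IsBestSplit x I s)
      (rest : NOTSelects x κ (J.filter fun I' => ¬(I'.1 < s ∧ s ≤ I'.2)) S) :
      NOTSelects x κ J (insert s S)

/-! ### The strengthened Schwarz information criterion -/

/-- The mean of the data over the segment `(p.1, p.2]`. -/
def segmentMean (x : ℕ → ℝ) (p : ℕ × ℕ) : ℝ :=
  (∑ t ∈ Finset.Ioc p.1 p.2, x t) / ((p.2 : ℝ) - p.1)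

/-- The residual sum of squares of the piecewise constant fit with change points `S`. -/
def rss (T : ℕ) (x : ℕ → ℝ) (S : Finset ℕ) : ℝ :=
  ∑ p ∈ segments T S, ∑ t ∈ Finset.Ioc p.1 p.2, (segmentMean x p - x t) ^ 2

/-- The strengthened Schwarz information criterion with exponent `θ`. For errors of variance `1`
the residual sum of squares is, up to an additive constant, `-2` times the maximised
log-likelihood; the weight `γ` is the number of parameters charged per change point (`2` if one
counts a location and a level). -/
def sSIC (γ θ : ℝ) (T : ℕ) (x : ℕ → ℝ) (S : Finset ℕ) : ℝ :=
  rss T x S + γ * (S.card : ℝ) * Real.log T ^ θ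

/-- `S` is an output, for the data `x 1, …, x T`, of seeded binary segmentation with decay `a` and
minimal segment length `m`, narrowest-over-threshold selection, and the threshold chosen among all
`κ ≥ 0` by minimising the strengthened Schwarz information criterion over the solution path
`κ ↦ path κ`. -/
def IsSeedBSEstimate (a : ℝ) (m : ℕ) (γ θ : ℝ) (T : ℕ) (x : ℕ → ℝ) (S : Finset ℕ) : Prop :=
  ∃ path : ℝ → Finset ℕ,
    (∀ κ, 0 ≤ κ → NOTSelects x κ (seededIntervals a m T) (path κ)) ∧
      ∃ κ₀, 0 ≤ κ₀ ∧ path κ₀ = S ∧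
        ∀ κ, 0 ≤ κ → sSIC γ θ T x (path κ₀) ≤ sSIC γ θ T x (path κ)

/-! ### The procedure always has an output -/

theorem exists_notSelects (x : ℕ → ℝ) (κ : ℝ) (J : Finset (ℕ × ℕ)) :
    ∃ S ⊆ J.biUnion (fun I => Finset.Ioo I.1 I.2), NOTSelects x κ J S := by
  classical
  induction J using Finset.strongInduction with
  | H J ih =>
    by_cases h : ∀ I ∈ J, ¬OverThreshold x κ I
    · exact ⟨∅, Finset.empty_subset _, .done h⟩
    · push Not at h
      obtain ⟨I₀, hI₀, ho₀⟩ := h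
      obtain ⟨I, hI, hmin⟩ := (J.filter (OverThreshold x κ)).exists_min_image
        (fun I => I.2 - I.1) ⟨I₀, Finset.mem_filter.2 ⟨hI₀, ho₀⟩⟩
      rw [Finset.mem_filter] at hI
      obtain ⟨s, hs, -⟩ := id hI.2
      have hsI := Finset.mem_Ioo.1 hs.1
      obtain ⟨S, hsub, hS⟩ := ih (J.filter fun I' => ¬(I'.1 < s ∧ s ≤ I'.2))
        ((Finset.filter_ssubset).2 ⟨I, hI.1, by simp only [not_not]; omega⟩)
      refine ⟨insert s S, ?_, .step hI.1 hI.2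
        (fun I' h' o' => hmin I' (Finset.mem_filter.2 ⟨h', o'⟩)) hs hS⟩
      rw [Finset.insert_subset_iff]
      exact ⟨Finset.mem_biUnion.2 ⟨I, hI.1, hs.1⟩,
        hsub.trans (Finset.biUnion_subset_biUnion_of_subset_left _ (Finset.filter_subset _ _))⟩

theorem exists_isSeedBSEstimate (a : ℝ) (m : ℕ) (γ θ : ℝ) (T : ℕ) (x : ℕ → ℝ) :
    ∃ S, IsSeedBSEstimate a m γ θ T x S := by
  choose path hsub hpath using fun κ => exists_notSelects x κ (seededIntervals a m T)
  have hfin : (path '' Set.Ici 0).Finite :=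
    (Finset.finite_toSet (Finset.powerset _)).subset (by
      rintro _ ⟨κ, -, rfl⟩
      exact Finset.mem_coe.2 (Finset.mem_powerset.2 (hsub κ)))
  obtain ⟨_, ⟨κ₀, h₀, rfl⟩, hmin⟩ :=
    Set.exists_min_image _ (sSIC γ θ T x) hfin ⟨path 0, 0, Set.self_mem_Ici, rfl⟩
  exact ⟨path κ₀, path, fun κ _ => hpath κ, κ₀, h₀, rfl, fun κ hκ => hmin _ ⟨κ, hκ, rfl⟩⟩

end

end SeedBS

namespace SeedBS

/-! ### The signal -/

/-! The argument is deterministic once every interval sum of errors has square at most `w` times the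
length. For `w = 8 log T` this has probability tending to 1, by Gaussian tails and a union bound
over the O(T²) intervals.

On this event the threshold (5N + 2)√w works. A squared CUSUM is the drop in residual sum of squares
caused by a split (`cusum_sq_eq`). Hence an interval above the threshold has a change point well
inside it, and if that is its only change point η, the best split lies within 24w/δ² of η
(`IsBestSplit.jump_sq_mul_abs_sub_le`). With d the minimal spacing, each change point is in the
middle part of a seeded interval of length at most d/2 whose gain exceeds the threshold. Choosing
the narrowest interval therefore always isolates one change point that is still undetected, and the
selection returns at most N estimates with one near each change point
(`NOTSelects.card_add_card_le`).

The data-driven threshold itself is never analysed: its set S only has to beat the set above in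
sSIC. A fit g with jumps in S has RSS at least Σε² + ‖f − g‖²/2 − 2w(|S| + N + 1), while the good
set has RSS at most Σε² + O(w). The penalty (log T)^θ dominates w, which excludes |S| > N. The
spacing (log T)^θ₀ dominates the penalty, which excludes a missed change point. With |S| = N the
penalties cancel, and ‖f − g‖² = O(log T) is the localisation rate (`card_eq_and_close_of_sSIC_le`).
-/

theorem mem_changePoints {T : ℕ} {f : ℕ → ℝ} {t : ℕ} :
    t ∈ changePoints T f ↔ 1 ≤ t ∧ t < T ∧ f t ≠ f (t + 1) := by
  simp [changePoints, and_assoc]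

theorem eq_of_no_changePoint {T : ℕ} {f : ℕ → ℝ} {t t' : ℕ} (ht : 1 ≤ t) (htt' : t ≤ t')
    (ht' : t' ≤ T) (h : ∀ η ∈ changePoints T f, ¬(t ≤ η ∧ η < t')) : f t = f t' := by
  induction t', htt' using Nat.le_induction with
  | base => rfl
  | succ n hn ih =>
    rw [ih (by omega) fun η hη hh => h η hη ⟨hh.1, by omega⟩]
    by_contra hne
    exact h n (mem_changePoints.2 ⟨by omega, by omega, hne⟩) ⟨hn, by omega⟩

/-- Writing the signal as a sum of single steps lets the linear CUSUM be bounded jump by jump, and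
lets a competitor be built by moving each step separately. -/
theorem signal_eq_sum {T : ℕ} (f : ℕ → ℝ) {t : ℕ} (ht : 1 ≤ t) (htT : t ≤ T) :
    f t = f 1 + ∑ η ∈ changePoints T f, if η < t then f (η + 1) - f η else 0 := by
  induction t, ht using Nat.le_induction with
  | base =>
    rw [Finset.sum_eq_zero, add_zero]
    intro η hη
    have := (mem_changePoints.1 hη).1
    rw [if_neg (by omega)]
  | succ n hn ih =>
    have hsplit : ∀ η ∈ changePoints T f, (if η < n + 1 then f (η + 1) - f η else 0) =
        (if η < n then f (η + 1) - f η else 0) + if η = n then f (η + 1) - f η else 0 := by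
      intro η _
      rcases lt_trichotomy η n with h | h | h
      · rw [if_pos (by omega), if_pos h, if_neg (by omega), add_zero]
      · rw [if_pos (by omega), if_neg (by omega), if_pos h, zero_add]
      · rw [if_neg (by omega), if_neg (by omega), if_neg (by omega), add_zero]
    rw [Finset.sum_congr rfl hsplit, Finset.sum_add_distrib, ← add_assoc, ← ih (by omega),
      Finset.sum_ite_eq' (changePoints T f) n]
    split_ifs with h
    · ring
    · have : f n = f (n + 1) := by
        by_contra hne
        exact h (mem_changePoints.2 ⟨hn, by omega, hne⟩)
      rw [add_zero, this]

theorem mem_segments {T : ℕ} {S : Finset ℕ} {p : ℕ × ℕ} :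
    p ∈ segments T S ↔ (p.1 ∈ insert 0 (insert T S) ∧ p.2 ∈ insert 0 (insert T S)) ∧
      p.1 < p.2 ∧ ∀ s ∈ S, ¬(p.1 < s ∧ s < p.2) := by
  rw [segments, Finset.mem_filter, Finset.mem_product]

/-- The minimum runs over consecutive points only; the successor `w` of `u` satisfies `w ≤ v`, which
covers all pairs. -/
theorem minSpacing_le_sub {T : ℕ} {S : Finset ℕ} {u v : ℕ}
    (hu : u ∈ insert 0 (insert T S)) (hv : v ∈ insert 0 (insert T S)) (huv : u < v) :
    minSpacing T S ≤ v - u := by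
  obtain ⟨w, hw, hmin⟩ := ((insert 0 (insert T S)).filter fun w => u < w).exists_min_image id
    ⟨v, Finset.mem_filter.2 ⟨hv, huv⟩⟩
  rw [Finset.mem_filter] at hw
  have hwv : w ≤ v := hmin v (Finset.mem_filter.2 ⟨hv, huv⟩)
  have hseg : (u, w) ∈ segments T S := by
    refine mem_segments.2 ⟨⟨hu, hw.1⟩, hw.2, fun s hs h => ?_⟩
    have : w ≤ s := hmin s (Finset.mem_filter.2 ⟨by simp [hs], h.1⟩)
    exact absurd h.2 (by simpa using this)
  have hle : minSpacing T S ≤ w - u := Nat.sInf_le ⟨(u, w), hseg, rfl⟩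
  omega

/-- The change points of `f` are at distance at least `d` from each other and from `0` and `T`. -/
structure Spaced (T : ℕ) (f : ℕ → ℝ) (d : ℕ) : Prop where
  le_left : ∀ η ∈ changePoints T f, d ≤ η
  le_right : ∀ η ∈ changePoints T f, η + d ≤ T
  le_sub : ∀ η ∈ changePoints T f, ∀ η' ∈ changePoints T f, η < η' → η + d ≤ η'

theorem spaced_minSpacing (T : ℕ) (f : ℕ → ℝ) :
    Spaced T f (minSpacing T (changePoints T f)) := by
  refine ⟨fun η hη => ?_, fun η hη => ?_, fun η hη η' hη' hlt => ?_⟩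
  · have h := mem_changePoints.1 hη
    simpa using minSpacing_le_sub (u := 0) (v := η) (S := changePoints T f) (T := T)
      (by simp) (by simp [hη]) (by omega)
  · have h := mem_changePoints.1 hη
    have := minSpacing_le_sub (u := η) (v := T) (S := changePoints T f) (T := T)
      (by simp [hη]) (by simp) (by omega)
    omega
  · have := minSpacing_le_sub (u := η) (v := η') (S := changePoints T f) (T := T)
      (by simp [hη]) (by simp [hη']) hlt
    omega

/-! ### Sums over integer intervals -/

theorem sum_Ioc_add {u v w : ℕ} (huv : u ≤ v) (hvw : v ≤ w) (F : ℕ → ℝ) :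
    ∑ t ∈ Finset.Ioc u v, F t + ∑ t ∈ Finset.Ioc v w, F t = ∑ t ∈ Finset.Ioc u w, F t := by
  exact Finset.sum_Ioc_consecutive F huv hvw

theorem sum_Ioc_const {u v : ℕ} (huv : u ≤ v) (c : ℝ) :
    ∑ _t ∈ Finset.Ioc u v, c = ((v : ℝ) - u) * c := by
  simp [Nat.cast_sub huv]

/-- Decomposition around the segment mean. It shows both that the mean is the least squares constant
and what its residual is. -/
theorem sum_sub_sq_eq {u v : ℕ} (huv : u < v) (x : ℕ → ℝ) (c : ℝ) :
    ∑ t ∈ Finset.Ioc u v, (x t - c) ^ 2 =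
      ∑ t ∈ Finset.Ioc u v, x t ^ 2 - (∑ t ∈ Finset.Ioc u v, x t) ^ 2 / ((v : ℝ) - u) +
        ((v : ℝ) - u) * (c - (∑ t ∈ Finset.Ioc u v, x t) / ((v : ℝ) - u)) ^ 2 := by
  have h : ∑ t ∈ Finset.Ioc u v, (x t - c) ^ 2 = ∑ t ∈ Finset.Ioc u v, x t ^ 2 -
      2 * c * ∑ t ∈ Finset.Ioc u v, x t + ((v : ℝ) - u) * c ^ 2 := by
    rw [← sum_Ioc_const huv.le, Finset.mul_sum, ← Finset.sum_sub_distrib, ← Finset.sum_add_distrib]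
    exact Finset.sum_congr rfl fun t _ => by ring
  have hpos : (0 : ℝ) < (v : ℝ) - u := sub_pos.2 (by exact_mod_cast huv)
  rw [h]
  field_simp
  ring

theorem sum_sq_div_le {u v : ℕ} (huv : u < v) (x : ℕ → ℝ) :
    (∑ t ∈ Finset.Ioc u v, x t) ^ 2 / ((v : ℝ) - u) ≤ ∑ t ∈ Finset.Ioc u v, x t ^ 2 := by
  have h := sum_sub_sq_eq huv x ((∑ t ∈ Finset.Ioc u v, x t) / ((v : ℝ) - u))
  rw [sub_self] at h
  have := Finset.sum_nonneg fun t (_ : t ∈ Finset.Ioc u v) =>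
    sq_nonneg (x t - (∑ t ∈ Finset.Ioc u v, x t) / ((v : ℝ) - u))
  linarith

/-- On every integer interval `(u, v]` up to `T`, the square of the sum of the errors `x - f` is at
most `w` times the length. -/
def NoiseControlled (T : ℕ) (f x : ℕ → ℝ) (w : ℝ) : Prop :=
  ∀ u v, u ≤ v → v ≤ T → (∑ t ∈ Finset.Ioc u v, (x t - f t)) ^ 2 ≤ w * ((v : ℝ) - u)

theorem NoiseControlled.le_sum_sub_sq {T : ℕ} {f x : ℕ → ℝ} {w : ℝ}
    (hx : NoiseControlled T f x w) (hw : 0 ≤ w) {u v : ℕ} (huv : u ≤ v) (hv : v ≤ T) {g : ℕ → ℝ}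
    {h : ℝ} (hg : ∀ t ∈ Finset.Ioc u v, f t - g t = h) :
    ∑ t ∈ Finset.Ioc u v, (x t - f t) ^ 2 + ((v : ℝ) - u) * h ^ 2 / 2 - 2 * w ≤
      ∑ t ∈ Finset.Ioc u v, (x t - g t) ^ 2 := by
  have hE := hx u v huv hv
  set E := ∑ t ∈ Finset.Ioc u v, (x t - f t) with hEdef
  have hn : (0 : ℝ) ≤ (v : ℝ) - u := sub_nonneg.2 (by exact_mod_cast huv)
  set n : ℝ := (v : ℝ) - u with hndef
  have heq : ∑ t ∈ Finset.Ioc u v, (x t - g t) ^ 2 =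
      ∑ t ∈ Finset.Ioc u v, (x t - f t) ^ 2 + 2 * h * E + n * h ^ 2 := by
    rw [hndef, hEdef, ← sum_Ioc_const huv, Finset.mul_sum, ← Finset.sum_add_distrib,
      ← Finset.sum_add_distrib]
    refine Finset.sum_congr rfl fun t ht => ?_
    rw [← hg t ht]
    ring
  -- The cross term is absorbed by AM-GM: 2|h|√(wn) ≤ nh²/2 + 2w.
  have hsq : (2 * h * E) ^ 2 ≤ (n * h ^ 2 / 2 + 2 * w) ^ 2 := by
    nlinarith [sq_nonneg (n * h ^ 2 / 2 - 2 * w), mul_le_mul_of_nonneg_left hE (sq_nonneg h)]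
  have := abs_le_of_sq_le_sq' hsq (by positivity)
  rw [heq]
  linarith [this.1]

/-! ### CUSUM statistics -/

theorem sqrt_mul_sub_sqrt_mul_sq {p q : ℝ} (hp : 0 < p) (hq : 0 < q) (A B : ℝ) :
    (√(q / ((p + q) * p)) * A - √(p / ((p + q) * q)) * B) ^ 2 =
      A ^ 2 / p + B ^ 2 / q - (A + B) ^ 2 / (p + q) := by
  have h1 : √(q / ((p + q) * p)) ^ 2 = q / ((p + q) * p) := Real.sq_sqrt (by positivity)
  have h2 : √(p / ((p + q) * q)) ^ 2 = p / ((p + q) * q) := Real.sq_sqrt (by positivity)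
  have h3 : √(q / ((p + q) * p)) * √(p / ((p + q) * q)) = 1 / (p + q) := by
    rw [← Real.sqrt_mul (by positivity)]
    rw [show q / ((p + q) * p) * (p / ((p + q) * q)) = (1 / (p + q)) ^ 2 by field_simp]
    exact Real.sqrt_sq (by positivity)
  calc _ = √(q / ((p + q) * p)) ^ 2 * A ^ 2 + √(p / ((p + q) * q)) ^ 2 * B ^ 2 -
        2 * (√(q / ((p + q) * p)) * √(p / ((p + q) * q))) * A * B := by ring
    _ = _ := by
      rw [h1, h2, h3]
      field_simp
      ring

/-- Up to the residual identity above, the right-hand side is the reduction in residual sum of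
squares when the interval is split at `s`, so a best split is a least squares split. -/
theorem cusum_sq_eq {x : ℕ → ℝ} {I : ℕ × ℕ} {s : ℕ} (h1 : I.1 < s) (h2 : s < I.2) :
    cusum x I s ^ 2 = (∑ t ∈ Finset.Ioc I.1 s, x t) ^ 2 / ((s : ℝ) - I.1) +
      (∑ t ∈ Finset.Ioc s I.2, x t) ^ 2 / ((I.2 : ℝ) - s) -
      (∑ t ∈ Finset.Ioc I.1 I.2, x t) ^ 2 / ((I.2 : ℝ) - I.1) := by
  have hp : (0 : ℝ) < (s : ℝ) - I.1 := sub_pos.2 (by exact_mod_cast h1)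
  have hq : (0 : ℝ) < (I.2 : ℝ) - s := sub_pos.2 (by exact_mod_cast h2)
  have := sqrt_mul_sub_sqrt_mul_sq hp hq (∑ t ∈ Finset.Ioc I.1 s, x t) (∑ t ∈ Finset.Ioc s I.2, x t)
  rw [sum_Ioc_add h1.le h2.le, show (s : ℝ) - I.1 + (I.2 - s) = I.2 - I.1 by ring] at this
  exact this

theorem cusum_sq_le {x : ℕ → ℝ} {I : ℕ × ℕ} {s : ℕ} (h1 : I.1 < s) (h2 : s < I.2) :
    cusum x I s ^ 2 ≤ (∑ t ∈ Finset.Ioc I.1 s, x t) ^ 2 / ((s : ℝ) - I.1) +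
      (∑ t ∈ Finset.Ioc s I.2, x t) ^ 2 / ((I.2 : ℝ) - s) := by
  have hn : (0 : ℝ) < (I.2 : ℝ) - I.1 := sub_pos.2 (by exact_mod_cast h1.trans h2)
  have : 0 ≤ (∑ t ∈ Finset.Ioc I.1 I.2, x t) ^ 2 / ((I.2 : ℝ) - I.1) := by positivity
  rw [cusum_sq_eq h1 h2]
  linarith

theorem cusum_sq_le_sum_sq {x : ℕ → ℝ} {I : ℕ × ℕ} {s : ℕ} (h1 : I.1 < s) (h2 : s < I.2) :
    cusum x I s ^ 2 ≤ ∑ t ∈ Finset.Ioc I.1 I.2, x t ^ 2 := by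
  refine (cusum_sq_le h1 h2).trans ?_
  rw [← sum_Ioc_add h1.le h2.le]
  exact add_le_add (sum_sq_div_le h1 x) (sum_sq_div_le h2 x)

theorem cusum_add (x y : ℕ → ℝ) (I : ℕ × ℕ) (s : ℕ) :
    cusum (fun t => x t + y t) I s = cusum x I s + cusum y I s := by
  simp only [cusum, Finset.sum_add_distrib]
  ring

theorem cusum_sum {ι : Type*} (A : Finset ι) (x : ι → ℕ → ℝ) (I : ℕ × ℕ) (s : ℕ) :
    cusum (fun t => ∑ i ∈ A, x i t) I s = ∑ i ∈ A, cusum (x i) I s := by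
  classical
  induction A using Finset.induction_on with
  | empty => simp [cusum]
  | insert i A hi ih =>
    simp only [Finset.sum_insert hi]
    rw [cusum_add, ih]

theorem cusum_congr {x y : ℕ → ℝ} {I : ℕ × ℕ} {s : ℕ} (h1 : I.1 ≤ s) (h2 : s ≤ I.2)
    (h : ∀ t ∈ Finset.Ioc I.1 I.2, x t = y t) : cusum x I s = cusum y I s := by
  have e1 : ∑ t ∈ Finset.Ioc I.1 s, x t = ∑ t ∈ Finset.Ioc I.1 s, y t :=
    Finset.sum_congr rfl fun t ht => h t (Finset.Ioc_subset_Ioc_right h2 ht)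
  have e2 : ∑ t ∈ Finset.Ioc s I.2, x t = ∑ t ∈ Finset.Ioc s I.2, y t :=
    Finset.sum_congr rfl fun t ht => h t (Finset.Ioc_subset_Ioc_left h1 ht)
  rw [cusum, cusum, e1, e2]

theorem cusum_const (c : ℝ) {I : ℕ × ℕ} {s : ℕ} (h1 : I.1 < s) (h2 : s < I.2) :
    cusum (fun _ => c) I s = 0 := by
  have hp : (0 : ℝ) < (s : ℝ) - I.1 := sub_pos.2 (by exact_mod_cast h1)
  have hq : (0 : ℝ) < (I.2 : ℝ) - s := sub_pos.2 (by exact_mod_cast h2)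
  have hn : (0 : ℝ) < (I.2 : ℝ) - I.1 := by linarith
  rw [← sq_eq_zero_iff, cusum_sq_eq h1 h2, sum_Ioc_const h1.le, sum_Ioc_const h2.le,
    sum_Ioc_const (h1.trans h2).le]
  field_simp
  ring

/-- The CUSUM annihilates constants, so the step may be replaced by minus its complement. Whichever
of the two has the smaller support gives the bound through its sum of squares. -/
theorem cusum_step_sq_le (c : ℝ) {I : ℕ × ℕ} {s η : ℕ} (h1 : I.1 < s) (h2 : s < I.2)
    (hη1 : I.1 < η) (hη2 : η < I.2) :
    cusum (fun t => if η < t then c else 0) I s ^ 2 ≤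
      c ^ 2 * min ((η : ℝ) - I.1) ((I.2 : ℝ) - η) := by
  have hle : ∀ d : ℝ, ∀ B : ℕ → Prop, [DecidablePred B] →
      ∑ t ∈ Finset.Ioc I.1 I.2, (if B t then d else 0) ^ 2 =
        d ^ 2 * ((Finset.Ioc I.1 I.2).filter B).card := by
    intro d B _
    simp_rw [ite_pow]
    rw [← Finset.sum_filter_add_sum_filter_not (Finset.Ioc I.1 I.2) B]
    rw [Finset.sum_congr (g := fun _ => d ^ 2) rfl
      fun t ht => if_pos (Finset.mem_filter.1 ht).2,
      Finset.sum_congr (s₁ := (Finset.Ioc I.1 I.2).filter fun t => ¬B t) (g := fun _ => 0) rfl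
      fun t ht => by rw [if_neg (Finset.mem_filter.1 ht).2]; ring]
    simp [mul_comm]
  rcases le_total ((η : ℝ) - I.1) ((I.2 : ℝ) - η) with h | h
  · rw [min_eq_left h]
    have hsplit := cusum_add (fun t => if η < t then c else 0)
      (fun t => if ¬η < t then c else 0) I s
    rw [cusum_congr (y := fun _ => c) h1.le h2.le (fun t _ => by by_cases h : η < t <;> simp [h]),
      cusum_const c h1 h2] at hsplit
    have hneg : cusum (fun t => if η < t then c else 0) I s ^ 2 =
        cusum (fun t => if ¬η < t then c else 0) I s ^ 2 := by
      rw [eq_neg_of_add_eq_zero_left hsplit.symm, neg_sq]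
    rw [hneg]
    refine (cusum_sq_le_sum_sq h1 h2).trans (le_of_eq ?_)
    rw [hle c (fun t => ¬η < t)]
    have : (Finset.Ioc I.1 I.2).filter (fun t => ¬η < t) = Finset.Ioc I.1 η := by
      ext t; simp only [Finset.mem_filter, Finset.mem_Ioc]; omega
    rw [this, Nat.card_Ioc, Nat.cast_sub hη1.le]
  · rw [min_eq_right h]
    refine (cusum_sq_le_sum_sq h1 h2).trans (le_of_eq ?_)
    rw [hle c (fun t => η < t)]
    have : (Finset.Ioc I.1 I.2).filter (fun t => η < t) = Finset.Ioc η I.2 := by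
      ext t; simp only [Finset.mem_filter, Finset.mem_Ioc]; omega
    rw [this, Nat.card_Ioc, Nat.cast_sub hη2.le]

theorem jump_sq (f : ℕ → ℝ) (t : ℕ) : jump f t ^ 2 = (f (t + 1) - f t) ^ 2 := sq_abs _

/-- The CUSUM statistic of the signal is small if all change points inside the interval are close
to its boundary. -/
theorem abs_cusum_signal_le {T : ℕ} {f : ℕ → ℝ} {I : ℕ × ℕ} {s : ℕ} (hI : I.2 ≤ T)
    (h1 : I.1 < s) (h2 : s < I.2) {b : ℝ} (hb : 0 ≤ b)
    (h : ∀ η ∈ changePoints T f, I.1 < η → η < I.2 →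
      jump f η ^ 2 * min ((η : ℝ) - I.1) ((I.2 : ℝ) - η) ≤ b ^ 2) :
    |cusum f I s| ≤ (changePoints T f).card * b := by
  rw [cusum_congr (y := fun t => f 1 + ∑ η ∈ changePoints T f,
    if η < t then f (η + 1) - f η else 0) h1.le h2.le, cusum_add (fun _ => f 1), cusum_const _ h1 h2,
    zero_add, cusum_sum, ← nsmul_eq_mul]
  · refine (Finset.abs_sum_le_sum_abs _ _).trans (Finset.sum_le_card_nsmul _ _ _ fun η hη => ?_)
    rcases le_or_gt η I.1 with hη1 | hη1
    · rw [cusum_congr (y := fun _ => f (η + 1) - f η) h1.le h2.le, cusum_const _ h1 h2, abs_zero]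
      · exact hb
      · intro t ht
        rw [if_pos (hη1.trans_lt (Finset.mem_Ioc.1 ht).1)]
    rcases le_or_gt I.2 η with hη2 | hη2
    · rw [cusum_congr (y := fun _ => 0) h1.le h2.le, cusum_const _ h1 h2, abs_zero]
      · exact hb
      · intro t ht
        rw [if_neg ((Finset.mem_Ioc.1 ht).2.trans hη2).not_gt]
    · refine abs_le_of_sq_le_sq ?_ hb
      refine (cusum_step_sq_le _ h1 h2 hη1 hη2).trans ?_
      rw [← jump_sq]
      exact h η hη hη1 hη2
  · intro t ht
    rw [Finset.mem_Ioc] at ht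
    exact signal_eq_sum f (by omega) (by omega)

/-- By linearity the difference is the CUSUM of the errors, whose square is at most `w` for each
side of the split, hence at most 2w. -/
theorem NoiseControlled.abs_cusum_sub_le {T : ℕ} {f x : ℕ → ℝ} {w : ℝ}
    (hx : NoiseControlled T f x w) (hw : 0 ≤ w) {I : ℕ × ℕ} (hI : I.2 ≤ T) {s : ℕ}
    (h1 : I.1 < s) (h2 : s < I.2) : |cusum x I s - cusum f I s| ≤ 2 * √w := by
  have hadd := cusum_add f (fun t => x t - f t) I s
  simp only [add_sub_cancel] at hadd
  have hsub : cusum x I s - cusum f I s = cusum (fun t => x t - f t) I s := by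
    rw [← sub_eq_of_eq_add' hadd]
  rw [hsub]
  refine abs_le_of_sq_le_sq ((cusum_sq_le h1 h2).trans ?_) (by positivity)
  have hp : (0 : ℝ) < (s : ℝ) - I.1 := sub_pos.2 (by exact_mod_cast h1)
  have hq : (0 : ℝ) < (I.2 : ℝ) - s := sub_pos.2 (by exact_mod_cast h2)
  have e1 := (div_le_iff₀ hp).2 (hx I.1 s h1.le (h2.le.trans hI))
  have e2 := (div_le_iff₀ hq).2 (hx s I.2 h2.le hI)
  rw [mul_pow, Real.sq_sqrt hw]
  linarith

/-- The price of fitting one constant across a jump: `u` and `v` are its errors on the two sides,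
and `u - v` is the jump. -/
theorem mul_sq_add_mul_sq_ge {p q u v m : ℝ} (hp : m ≤ p) (hq : m ≤ q) (hm : 0 ≤ m) :
    m * (u - v) ^ 2 / 2 ≤ p * u ^ 2 + q * v ^ 2 := by
  nlinarith [mul_le_mul_of_nonneg_right hp (sq_nonneg u),
    mul_le_mul_of_nonneg_right hq (sq_nonneg v), mul_nonneg hm (sq_nonneg (u + v))]

/-- The threshold with which narrowest-over-threshold selection finds all `N` change points if the
noise level is `w`. -/
noncomputable def threshold (N : ℕ) (w : ℝ) : ℝ := (5 * N + 2) * √w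

theorem abs_cusum_le_threshold {T : ℕ} {f x : ℕ → ℝ} {w : ℝ}
    (hx : NoiseControlled T f x w) (hw : 0 ≤ w) {I : ℕ × ℕ} (hI : I.2 ≤ T) {s : ℕ}
    (h1 : I.1 < s) (h2 : s < I.2)
    (h : ∀ η ∈ changePoints T f, I.1 < η → η < I.2 →
      jump f η ^ 2 * min ((η : ℝ) - I.1) ((I.2 : ℝ) - η) ≤ 24 * w) :
    |cusum x I s| ≤ threshold (changePoints T f).card w := by
  have e1 := hx.abs_cusum_sub_le hw hI h1 h2
  -- Each jump contributes at most 5√w because 24w ≤ (5√w)²; the noise adds 2√w. This is the origin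
  -- of 5N + 2.
  have e2 := abs_cusum_signal_le (b := 5 * √w) hI h1 h2 (by positivity) fun η hη a b =>
    (h η hη a b).trans (by rw [mul_pow, Real.sq_sqrt hw]; linarith)
  have e3 := abs_add_le (cusum x I s - cusum f I s) (cusum f I s)
  rw [sub_add_cancel] at e3
  rw [threshold]
  linarith

theorem OverThreshold.lt_abs_cusum {x : ℕ → ℝ} {κ : ℝ} {I : ℕ × ℕ} (h : OverThreshold x κ I)
    {s : ℕ} (hs : IsBestSplit x I s) : κ < |cusum x I s| := by
  obtain ⟨s', hs', hlt⟩ := h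
  exact hlt.trans_le (hs.2 s' hs'.1)

/-- The best split of an interval with a single change point and a large gain is close to that
change point. -/
theorem IsBestSplit.jump_sq_mul_abs_sub_le {T : ℕ} {f x : ℕ → ℝ} {w : ℝ}
    (hx : NoiseControlled T f x w) (hw : 0 ≤ w) {I : ℕ × ℕ} (hI : I.2 ≤ T) {s η : ℕ}
    (hs : IsBestSplit x I s) (hη1 : I.1 < η) (hη2 : η < I.2)
    (huniq : ∀ η' ∈ changePoints T f, I.1 < η' → η' < I.2 → η' = η)
    (hover : threshold (changePoints T f).card w < |cusum x I s|) :
    jump f η ^ 2 * |(s : ℝ) - η| ≤ 24 * w := by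
  obtain ⟨h1, h2⟩ := Finset.mem_Ioo.1 hs.1
  have hbest := sq_le_sq.2 (hs.2 η (Finset.mem_Ioo.2 ⟨hη1, hη2⟩))
  rw [cusum_sq_eq h1 h2, cusum_sq_eq hη1 hη2] at hbest
  -- A change point within 24w/δ² of the boundary could not produce a gain above the threshold.
  have hfar : 24 * w < jump f η ^ 2 * min ((η : ℝ) - I.1) ((I.2 : ℝ) - η) := by
    by_contra hcon
    refine hover.not_ge (abs_cusum_le_threshold hx hw hI h1 h2 fun η' hη' a b => ?_)
    rw [huniq η' hη' a b]
    exact not_lt.1 hcon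
  have hleft : ∀ t, I.1 < t → t ≤ η → f t = f η := fun t ht ht' =>
    eq_of_no_changePoint (T := T) (by omega) ht' (by omega) fun η' hη' hh => by
      have := huniq η' hη' (by omega) (by omega); omega
  have hright : ∀ t, η < t → t ≤ I.2 → f t = f (η + 1) := fun t ht ht' =>
    (eq_of_no_changePoint (T := T) (by omega) ht (by omega) fun η' hη' hh => by
      have := huniq η' hη' (by omega) (by omega); omega).symm
  have cs1 : (I.1 : ℝ) < s := by exact_mod_cast h1
  have cs2 : (s : ℝ) < I.2 := by exact_mod_cast h2
  -- the fit with the change point at `η` is at least as good as the true signal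
  have up1 := sum_sub_sq_eq hη1 x (f η)
  have up2 := sum_sub_sq_eq hη2 x (f (η + 1))
  rw [← Finset.sum_congr (f := fun t => (x t - f t) ^ 2) rfl (fun t ht => by
    rw [hleft t (Finset.mem_Ioc.1 ht).1 (Finset.mem_Ioc.1 ht).2])] at up1
  rw [← Finset.sum_congr (f := fun t => (x t - f t) ^ 2) rfl (fun t ht => by
    rw [hright t (Finset.mem_Ioc.1 ht).1 (Finset.mem_Ioc.1 ht).2])] at up2
  have cη1 : (I.1 : ℝ) < η := by exact_mod_cast hη1
  have cη2 : (η : ℝ) < I.2 := by exact_mod_cast hη2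
  have p1 : 0 ≤ ((η : ℝ) - I.1) * (f η - (∑ t ∈ Finset.Ioc I.1 η, x t) / ((η : ℝ) - I.1)) ^ 2 :=
    mul_nonneg (by linarith) (sq_nonneg _)
  have p2 : 0 ≤ ((I.2 : ℝ) - η) *
      (f (η + 1) - (∑ t ∈ Finset.Ioc η I.2, x t) / ((I.2 : ℝ) - η)) ^ 2 :=
    mul_nonneg (by linarith) (sq_nonneg _)
  have lo1 := sum_sub_sq_eq h1 x ((∑ t ∈ Finset.Ioc I.1 s, x t) / ((s : ℝ) - I.1))
  have lo2 := sum_sub_sq_eq h2 x ((∑ t ∈ Finset.Ioc s I.2, x t) / ((I.2 : ℝ) - s))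
  rw [sub_self] at lo1 lo2
  set c := (∑ t ∈ Finset.Ioc I.1 s, x t) / ((s : ℝ) - I.1)
  set d := (∑ t ∈ Finset.Ioc s I.2, x t) / ((I.2 : ℝ) - s)
  have sx1 := sum_Ioc_add h1.le h2.le fun t => x t ^ 2
  have sx2 := sum_Ioc_add hη1.le hη2.le fun t => x t ^ 2
  have hJ := jump_sq f η
  -- The points `s` and `η` cut the interval into three pieces, each losing at most 2w to the noise.
  -- The constant fit on the segment across `η` costs at least δ²·min/4, so δ²·min ≤ 4·6w = 24w.
  rcases le_total s η with hsη | hsη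
  · have csη : (s : ℝ) ≤ η := by exact_mod_cast hsη
    have k1 := hx.le_sum_sub_sq hw h1.le (h2.le.trans hI) (g := fun _ => c) (h := f η - c)
      fun t ht => by
        have := Finset.mem_Ioc.1 ht
        rw [hleft t this.1 (by omega)]
    have k2 := hx.le_sum_sub_sq hw hsη (hη2.le.trans hI) (g := fun _ => d) (h := f η - d)
      fun t ht => by
        have := Finset.mem_Ioc.1 ht
        rw [hleft t (by omega) (by omega)]
    have k3 := hx.le_sum_sub_sq hw hη2.le hI (g := fun _ => d) (h := f (η + 1) - d)
      fun t ht => by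
        have := Finset.mem_Ioc.1 ht
        rw [hright t (by omega) (by omega)]
    have s1 := sum_Ioc_add hsη hη2.le fun t => (x t - d) ^ 2
    have s2 := sum_Ioc_add hsη hη2.le fun t => (x t - f t) ^ 2
    have s3 := sum_Ioc_add h1.le h2.le fun t => (x t - f t) ^ 2
    have s4 := sum_Ioc_add hη1.le hη2.le fun t => (x t - f t) ^ 2
    have p3 : 0 ≤ ((s : ℝ) - I.1) * (f η - c) ^ 2 := mul_nonneg (by linarith) (sq_nonneg _)
    have hm := mul_sq_add_mul_sq_ge (u := f η - d) (v := f (η + 1) - d)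
      (min_le_left ((η : ℝ) - s) ((I.2 : ℝ) - η)) (min_le_right _ _)
      (le_min (by linarith) (by linarith))
    rw [show (f η - d - (f (η + 1) - d)) ^ 2 = jump f η ^ 2 by rw [hJ]; ring] at hm
    have hmin : jump f η ^ 2 * min ((η : ℝ) - s) ((I.2 : ℝ) - η) ≤ 24 * w := by linarith
    rw [abs_sub_comm, abs_of_nonneg (by linarith)]
    -- The minimum cannot be the distance from `η` to the boundary, by `hfar`.
    rcases min_choice ((η : ℝ) - s) ((I.2 : ℝ) - η) with h | h
    · rwa [h] at hmin
    · rw [h] at hmin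
      have := mul_le_mul_of_nonneg_left (min_le_right ((η : ℝ) - I.1) ((I.2 : ℝ) - η))
        (sq_nonneg (jump f η))
      linarith
  · have csη : (η : ℝ) ≤ s := by exact_mod_cast hsη
    have k1 := hx.le_sum_sub_sq hw hη1.le (hη2.le.trans hI) (g := fun _ => c) (h := f η - c)
      fun t ht => by
        have := Finset.mem_Ioc.1 ht
        rw [hleft t this.1 (by omega)]
    have k2 := hx.le_sum_sub_sq hw hsη (h2.le.trans hI) (g := fun _ => c) (h := f (η + 1) - c)
      fun t ht => by
        have := Finset.mem_Ioc.1 ht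
        rw [hright t (by omega) (by omega)]
    have k3 := hx.le_sum_sub_sq hw h2.le hI (g := fun _ => d) (h := f (η + 1) - d)
      fun t ht => by
        have := Finset.mem_Ioc.1 ht
        rw [hright t (by omega) (by omega)]
    have s1 := sum_Ioc_add hη1.le hsη fun t => (x t - c) ^ 2
    have s2 := sum_Ioc_add hη1.le hsη fun t => (x t - f t) ^ 2
    have s3 := sum_Ioc_add h1.le h2.le fun t => (x t - f t) ^ 2
    have s4 := sum_Ioc_add hη1.le hη2.le fun t => (x t - f t) ^ 2
    have p3 : 0 ≤ ((I.2 : ℝ) - s) * (f (η + 1) - d) ^ 2 := mul_nonneg (by linarith) (sq_nonneg _)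
    have hm := mul_sq_add_mul_sq_ge (u := f η - c) (v := f (η + 1) - c)
      (min_le_left ((η : ℝ) - I.1) ((s : ℝ) - η)) (min_le_right _ _)
      (le_min (by linarith) (by linarith))
    rw [show (f η - c - (f (η + 1) - c)) ^ 2 = jump f η ^ 2 by rw [hJ]; ring] at hm
    have hmin : jump f η ^ 2 * min ((η : ℝ) - I.1) ((s : ℝ) - η) ≤ 24 * w := by linarith
    rw [abs_of_nonneg (by linarith)]
    rcases min_choice ((η : ℝ) - I.1) ((s : ℝ) - η) with h | h
    · rw [h] at hmin
      have := mul_le_mul_of_nonneg_left (min_le_left ((η : ℝ) - I.1) ((I.2 : ℝ) - η))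
        (sq_nonneg (jump f η))
      linarith
    · rwa [h] at hmin

/-! ### Narrowest-over-threshold selection -/

theorem NOTSelects.subset {x : ℕ → ℝ} {κ : ℝ} {J : Finset (ℕ × ℕ)} {S : Finset ℕ}
    (h : NOTSelects x κ J S) {T : ℕ} (hJ : ∀ I ∈ J, I.2 ≤ T) : S ⊆ Finset.Ioo 0 T := by
  induction h with
  | done _ => exact Finset.empty_subset _
  | @step J S I s mem _ _ best _ ih =>
    have hs := Finset.mem_Ioo.1 best.1
    have hI := hJ I mem
    exact Finset.insert_subset (Finset.mem_Ioo.2 ⟨by omega, by omega⟩)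
      (ih fun I' hI' => hJ I' (Finset.mem_filter.1 hI').1)

theorem two_mul_abs_sub_lt {f : ℕ → ℝ} {w : ℝ} {d : ℕ} {s η : ℕ}
    (hd : 48 * w < jump f η ^ 2 * d) (hs : jump f η ^ 2 * |(s : ℝ) - η| ≤ 24 * w) :
    2 * s < 2 * η + d ∧ 2 * η < 2 * s + d := by
  have h : 2 * |(s : ℝ) - η| < d := by
    by_contra hcon
    have := mul_le_mul_of_nonneg_left (not_lt.1 hcon) (sq_nonneg (jump f η))
    linarith
  constructor
  · have : (2 * s : ℝ) < 2 * η + d := by linarith [le_abs_self ((s : ℝ) - η)]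
    exact_mod_cast this
  · have : (2 * η : ℝ) < 2 * s + d := by linarith [neg_abs_le ((s : ℝ) - η)]
    exact_mod_cast this

/-- Suppose that every change point outside the set `D` is the only one in a short interval of `J`
with large gain, and that the change points in `D` have estimates that belong to no interval of `J`.
Then selection from `J` finds precisely the change points outside `D`. -/
theorem NOTSelects.card_add_card_le {T : ℕ} {f x : ℕ → ℝ} {w : ℝ} (hx : NoiseControlled T f x w)
    (hw : 0 ≤ w) {d : ℕ} (hd : Spaced T f d)
    (hdw : ∀ η ∈ changePoints T f, 48 * w < jump f η ^ 2 * d) {good : ℕ → ℕ × ℕ}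
    (hgood : ∀ η ∈ changePoints T f, (good η).1 < η ∧ η < (good η).2 ∧
      2 * ((good η).2 - (good η).1) ≤ d ∧
      OverThreshold x (threshold (changePoints T f).card w) (good η))
    {J : Finset (ℕ × ℕ)} {S : Finset ℕ}
    (h : NOTSelects x (threshold (changePoints T f).card w) J S)
    (hJ : ∀ I ∈ J, I.2 ≤ T) (D : Finset ℕ) (hD : D ⊆ changePoints T f)
    (hund : ∀ η ∈ changePoints T f, η ∉ D → good η ∈ J)
    (hdet : ∀ η ∈ D, ∃ s : ℕ, jump f η ^ 2 * |(s : ℝ) - η| ≤ 24 * w ∧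
      ∀ I ∈ J, ¬(I.1 < s ∧ s ≤ I.2)) :
    S.card + D.card ≤ (changePoints T f).card ∧
      ∀ η ∈ changePoints T f, η ∉ D → ∃ s ∈ S, jump f η ^ 2 * |(s : ℝ) - η| ≤ 24 * w := by
  induction h generalizing D with
  | done none_over =>
    refine ⟨by simpa using Finset.card_le_card hD, fun η hη hηD => ?_⟩
    exact absurd (hgood η hη).2.2.2 (none_over _ (hund η hη hηD))
  | @step J S I s mem is_over narrowest best _ ih =>
    have hIT := hJ I mem
    obtain ⟨h1, h2⟩ := Finset.mem_Ioo.1 best.1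
    have hgain := is_over.lt_abs_cusum best
    -- If all change points inside `I` were detected, their estimates would lie outside `I`, as
    -- intervals containing them are gone. These change points would then be near the boundary of
    -- `I`, and the gain would be too small.
    obtain ⟨η, hη, hη1, hη2, hηD⟩ :
        ∃ η ∈ changePoints T f, I.1 < η ∧ η < I.2 ∧ η ∉ D := by
      by_contra! hcon
      refine hgain.not_ge (abs_cusum_le_threshold hx hw hIT h1 h2 fun η hη a b => ?_)
      obtain ⟨s', hs', hs'J⟩ := hdet η (hcon η hη a b)
      refine (mul_le_mul_of_nonneg_left ?_ (sq_nonneg _)).trans hs'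
      have hout := hs'J I mem
      rcases le_or_gt s' I.1 with h | h
      · have : (s' : ℝ) ≤ I.1 := by exact_mod_cast h
        exact (min_le_left _ _).trans (by linarith [neg_abs_le ((s' : ℝ) - η)])
      · have h' : I.2 ≤ s' := by omega
        have : (I.2 : ℝ) ≤ s' := by exact_mod_cast h'
        exact (min_le_right _ _).trans (by linarith [le_abs_self ((s' : ℝ) - η)])
    obtain ⟨g1, g2, glen, gover⟩ := hgood η hη
    -- `I` is no longer than `good η`, hence at most d/2 long, so `η` is its only change point.
    have hshort := narrowest _ (hund η hη hηD) gover
    have huniq : ∀ η' ∈ changePoints T f, I.1 < η' → η' < I.2 → η' = η := by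
      intro η' hη' a b
      rcases lt_trichotomy η' η with h | h | h
      · have := hd.le_sub η' hη' η hη h; omega
      · exact h
      · have := hd.le_sub η hη η' hη' h; omega
    have hloc := best.jump_sq_mul_abs_sub_le hx hw hIT hη1 hη2 huniq hgain
    have hclose := two_mul_abs_sub_lt (hdw η hη) hloc
    -- Now `η` counts as detected. The good intervals of the other undetected change points survive:
    -- `s` is less than d/2 from `η`, and these intervals have length at most d/2 around points at
    -- least d away.
    obtain ⟨c1, c2⟩ := ih (fun I' hI' => hJ I' (Finset.mem_filter.1 hI').1) (insert η D)
      (Finset.insert_subset hη hD)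
      (by
        intro η' hη' hη'D
        rw [Finset.mem_insert, not_or] at hη'D
        refine Finset.mem_filter.2 ⟨hund η' hη' hη'D.2, ?_⟩
        obtain ⟨g1', g2', glen', -⟩ := hgood η' hη'
        rcases lt_or_gt_of_ne hη'D.1 with h | h
        · have := hd.le_sub η' hη' η hη h; omega
        · have := hd.le_sub η hη η' hη' h; omega)
      (by
        intro η' hη'
        rcases Finset.mem_insert.1 hη' with rfl | hη'
        · exact ⟨s, hloc, fun I' hI' => (Finset.mem_filter.1 hI').2⟩
        · obtain ⟨s', hs', hs'J⟩ := hdet η' hη'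
          exact ⟨s', hs', fun I' hI' => hs'J I' (Finset.mem_filter.1 hI').1⟩)
    rw [Finset.card_insert_of_notMem hηD] at c1
    refine ⟨by have := Finset.card_insert_le s S; omega, fun η' hη' hη'D => ?_⟩
    by_cases he : η' = η
    · exact ⟨s, Finset.mem_insert_self _ _, he ▸ hloc⟩
    · obtain ⟨s', hs', h'⟩ := c2 η' hη' (by simp [he, hη'D])
      exact ⟨s', Finset.mem_insert_of_mem hs', h'⟩

/-! ### Residual sums of squares -/

theorem le_of_mem_insert {T : ℕ} {S : Finset ℕ} (hS : S ⊆ Finset.Ioo 0 T) {e : ℕ}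
    (he : e ∈ insert 0 (insert T S)) : e ≤ T := by
  rcases Finset.mem_insert.1 he with rfl | he
  · omega
  rcases Finset.mem_insert.1 he with rfl | he
  · exact le_rfl
  · exact (Finset.mem_Ioo.1 (hS he)).2.le

theorem notMem_Ioo_of_mem_segments {T : ℕ} {S : Finset ℕ} (hS : S ⊆ Finset.Ioo 0 T) {p : ℕ × ℕ}
    (hp : p ∈ segments T S) {e : ℕ} (he : e ∈ insert 0 (insert T S)) :
    ¬(p.1 < e ∧ e < p.2) := by
  obtain ⟨⟨-, hp2⟩, -, hp3⟩ := mem_segments.1 hp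
  have := le_of_mem_insert hS hp2
  rcases Finset.mem_insert.1 he with rfl | he
  · omega
  rcases Finset.mem_insert.1 he with rfl | he
  · omega
  · exact hp3 e he

theorem eq_of_mem_segments {T : ℕ} {S : Finset ℕ} (hS : S ⊆ Finset.Ioo 0 T) {p q : ℕ × ℕ} {t : ℕ}
    (hp : p ∈ segments T S) (hq : q ∈ segments T S) (htp : t ∈ Finset.Ioc p.1 p.2)
    (htq : t ∈ Finset.Ioc q.1 q.2) : p = q := by
  rw [Finset.mem_Ioc] at htp htq
  obtain ⟨⟨hp1, hp2⟩, -⟩ := mem_segments.1 hp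
  obtain ⟨⟨hq1, hq2⟩, -⟩ := mem_segments.1 hq
  have a := notMem_Ioo_of_mem_segments hS hp hq1
  have b := notMem_Ioo_of_mem_segments hS hp hq2
  have c := notMem_Ioo_of_mem_segments hS hq hp1
  have d := notMem_Ioo_of_mem_segments hS hq hp2
  exact Prod.ext (by omega) (by omega)

theorem exists_mem_segments {T : ℕ} (S : Finset ℕ) {t : ℕ} (ht : t ∈ Finset.Ioc 0 T) :
    ∃ p ∈ segments T S, t ∈ Finset.Ioc p.1 p.2 := by
  rw [Finset.mem_Ioc] at ht
  obtain ⟨u, hu, hmax⟩ := ((insert 0 (insert T S)).filter fun w => w < t).exists_max_image id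
    ⟨0, Finset.mem_filter.2 ⟨by simp, ht.1⟩⟩
  obtain ⟨v, hv, hmin⟩ := ((insert 0 (insert T S)).filter fun w => t ≤ w).exists_min_image id
    ⟨T, Finset.mem_filter.2 ⟨by simp, ht.2⟩⟩
  rw [Finset.mem_filter] at hu hv
  refine ⟨(u, v), mem_segments.2 ⟨⟨hu.1, hv.1⟩, hu.2.trans_le hv.2, fun s hs h => ?_⟩,
    Finset.mem_Ioc.2 ⟨hu.2, hv.2⟩⟩
  have hs' : s ∈ insert 0 (insert T S) := by simp [hs]
  simp only at h
  rcases lt_or_ge s t with h' | h'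
  · have : s ≤ u := hmax s (Finset.mem_filter.2 ⟨hs', h'⟩)
    omega
  · have : v ≤ s := hmin s (Finset.mem_filter.2 ⟨hs', h'⟩)
    omega

theorem sum_segments {T : ℕ} {S : Finset ℕ} (hS : S ⊆ Finset.Ioo 0 T) (F : ℕ → ℝ) :
    ∑ p ∈ segments T S, ∑ t ∈ Finset.Ioc p.1 p.2, F t = ∑ t ∈ Finset.Ioc 0 T, F t := by
  rw [← Finset.sum_biUnion]
  · congr 1
    ext t
    rw [Finset.mem_biUnion]
    constructor
    · rintro ⟨p, hp, ht⟩
      have := le_of_mem_insert hS (mem_segments.1 hp).1.2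
      rw [Finset.mem_Ioc] at ht ⊢
      omega
    · exact exists_mem_segments S
  · intro p hp q hq hpq
    refine Finset.disjoint_left.2 fun t htp htq => hpq (eq_of_mem_segments hS hp hq htp htq)

theorem card_segments_le {T : ℕ} {S : Finset ℕ} (hS : S ⊆ Finset.Ioo 0 T) :
    (segments T S).card ≤ S.card + 1 := by
  refine le_trans ?_ (Finset.card_insert_le 0 S)
  refine Finset.card_le_card_of_injOn Prod.fst (fun p hp => ?_) fun p hp q hq hpq => ?_
  · obtain ⟨⟨hp1, hp2⟩, hlt, -⟩ := mem_segments.1 hp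
    have := le_of_mem_insert hS hp2
    have hne : p.1 ≠ T := by omega
    simpa [hne] using hp1
  · have hp' := mem_segments.1 hp
    have hq' := mem_segments.1 hq
    exact eq_of_mem_segments (t := p.1 + 1) hS hp hq (Finset.mem_Ioc.2 ⟨by omega, by omega⟩)
      (Finset.mem_Ioc.2 ⟨by omega, by omega⟩)

/-- `g` is constant on each segment `(u, v]` of `{1, …, T}` cut at the points of `S`. -/
def ConstOff (T : ℕ) (S : Finset ℕ) (g : ℕ → ℝ) : Prop :=
  ∀ t t', 1 ≤ t → t ≤ t' → t' ≤ T → (∀ s ∈ S, ¬(t ≤ s ∧ s < t')) → g t = g t'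

theorem constOff_signal (T : ℕ) (f : ℕ → ℝ) : ConstOff T (changePoints T f) f :=
  fun _ _ ht htt' ht' h => eq_of_no_changePoint ht htt' ht' h

theorem ConstOff.eq_on_segment {T : ℕ} {S : Finset ℕ} {g : ℕ → ℝ} (hS : S ⊆ Finset.Ioo 0 T)
    (hg : ConstOff T S g) {p : ℕ × ℕ} (hp : p ∈ segments T S) {t : ℕ}
    (ht : t ∈ Finset.Ioc p.1 p.2) : g t = g p.2 := by
  rw [Finset.mem_Ioc] at ht
  obtain ⟨⟨-, hp2⟩, -, hp3⟩ := mem_segments.1 hp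
  exact hg t p.2 (by omega) ht.2 (le_of_mem_insert hS hp2) fun s hs h =>
    hp3 s hs ⟨by omega, h.2⟩

/-- Together with `exists_rss_eq`, this identifies the residual sum of squares as a minimum over
functions `g`, so that different segmentations can be compared pointwise. -/
theorem rss_le {T : ℕ} {S : Finset ℕ} (hS : S ⊆ Finset.Ioo 0 T) (x : ℕ → ℝ) {g : ℕ → ℝ}
    (hg : ConstOff T S g) : rss T x S ≤ ∑ t ∈ Finset.Ioc 0 T, (x t - g t) ^ 2 := by
  rw [rss, ← sum_segments hS]
  refine Finset.sum_le_sum fun p hp => ?_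
  have hlt := (mem_segments.1 hp).2.1
  have hpos : (0 : ℝ) < (p.2 : ℝ) - p.1 := sub_pos.2 (by exact_mod_cast hlt)
  rw [Finset.sum_congr (f := fun t => (x t - g t) ^ 2) (g := fun t => (x t - g p.2) ^ 2) rfl
    fun t ht => by rw [hg.eq_on_segment hS hp ht]]
  simp_rw [sub_sq_comm (segmentMean x p)]
  rw [sum_sub_sq_eq hlt x (g p.2), sum_sub_sq_eq hlt x (segmentMean x p), segmentMean, sub_self]
  have := mul_nonneg hpos.le (sq_nonneg (g p.2 - (∑ t ∈ Finset.Ioc p.1 p.2, x t) / (p.2 - p.1)))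
  linarith

theorem exists_rss_eq {T : ℕ} {S : Finset ℕ} (hS : S ⊆ Finset.Ioo 0 T) (x : ℕ → ℝ) :
    ∃ g, ConstOff T S g ∧ rss T x S = ∑ t ∈ Finset.Ioc 0 T, (x t - g t) ^ 2 := by
  choose! seg hseg hmem using fun t (ht : t ∈ Finset.Ioc 0 T) => exists_mem_segments S ht
  refine ⟨fun t => segmentMean x (seg t), fun t t' ht htt' ht' h => ?_, ?_⟩
  · have htm : t ∈ Finset.Ioc 0 T := Finset.mem_Ioc.2 ⟨ht, htt'.trans ht'⟩
    have htm' : t' ∈ Finset.Ioc 0 T := Finset.mem_Ioc.2 ⟨by omega, ht'⟩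
    have hm := Finset.mem_Ioc.1 (hmem t htm)
    have heq : seg t = seg t' := by
      refine eq_of_mem_segments hS (hseg t htm) (hseg t' htm') (t := t') ?_ (hmem t' htm')
      refine Finset.mem_Ioc.2 ⟨by omega, ?_⟩
      have he := (mem_segments.1 (hseg t htm)).1.2
      by_contra hlt
      rcases Finset.mem_insert.1 he with h0 | he
      · omega
      rcases Finset.mem_insert.1 he with h0 | he
      · omega
      · exact h _ he ⟨hm.2, by omega⟩
    simp only [heq]
  · rw [rss, ← sum_segments hS]
    refine Finset.sum_congr rfl fun p hp => Finset.sum_congr rfl fun t ht => ?_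
    have htT : t ∈ Finset.Ioc 0 T := by
      have := le_of_mem_insert hS (mem_segments.1 hp).1.2
      rw [Finset.mem_Ioc] at ht ⊢
      omega
    simp only [eq_of_mem_segments hS (hseg t htT) hp (hmem t htT) ht]
    exact sub_sq_comm _ _

theorem changePoints_subset (T : ℕ) (f : ℕ → ℝ) : changePoints T f ⊆ Finset.Ioo 0 T := by
  intro t ht
  have := mem_changePoints.1 ht
  exact Finset.mem_Ioo.2 ⟨by omega, by omega⟩

/-- A lower bound for the residual sum of squares of any piecewise constant fit. -/
theorem NoiseControlled.le_sum_sub_sq_of_constOff {T : ℕ} {f x : ℕ → ℝ} {w : ℝ}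
    (hx : NoiseControlled T f x w) (hw : 0 ≤ w) {S : Finset ℕ} (hS : S ⊆ Finset.Ioo 0 T)
    {g : ℕ → ℝ} (hg : ConstOff T S g) :
    ∑ t ∈ Finset.Ioc 0 T, (x t - f t) ^ 2 + (∑ t ∈ Finset.Ioc 0 T, (f t - g t) ^ 2) / 2 -
        2 * w * (S.card + (changePoints T f).card + 1) ≤
      ∑ t ∈ Finset.Ioc 0 T, (x t - g t) ^ 2 := by
  have hU : S ∪ changePoints T f ⊆ Finset.Ioo 0 T :=
    Finset.union_subset hS (changePoints_subset T f)
  have hcard : ((segments T (S ∪ changePoints T f)).card : ℝ) ≤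
      S.card + (changePoints T f).card + 1 := by
    have h1 := card_segments_le hU
    have h2 := Finset.card_union_le S (changePoints T f)
    exact_mod_cast h1.trans (by omega)
  have hgU : ConstOff T (S ∪ changePoints T f) g := fun t t' a b c h =>
    hg t t' a b c fun s hs => h s (Finset.mem_union_left _ hs)
  have hfU : ConstOff T (S ∪ changePoints T f) f := fun t t' a b c h =>
    constOff_signal T f t t' a b c fun s hs => h s (Finset.mem_union_right _ hs)
  -- On the common refinement both `f` and `g` are constant on each piece, and each piece loses at
  -- most 2w.
  have hpiece : ∀ p ∈ segments T (S ∪ changePoints T f),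
      ∑ t ∈ Finset.Ioc p.1 p.2, ((x t - f t) ^ 2 + (f t - g t) ^ 2 / 2) - 2 * w ≤
        ∑ t ∈ Finset.Ioc p.1 p.2, (x t - g t) ^ 2 := by
    intro p hp
    have hlt := (mem_segments.1 hp).2.1
    have hconst : ∀ t ∈ Finset.Ioc p.1 p.2, f t - g t = f p.2 - g p.2 := fun t ht => by
      rw [hgU.eq_on_segment hU hp ht, hfU.eq_on_segment hU hp ht]
    have := hx.le_sum_sub_sq hw hlt.le (le_of_mem_insert hU (mem_segments.1 hp).1.2) hconst
    rw [Finset.sum_add_distrib, Finset.sum_congr (f := fun t => (f t - g t) ^ 2 / 2)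
      (g := fun _ => (f p.2 - g p.2) ^ 2 / 2) rfl fun t ht => by rw [hconst t ht],
      sum_Ioc_const hlt.le]
    linarith
  have hsum := Finset.sum_le_sum hpiece
  rw [Finset.sum_sub_distrib, sum_segments hU, sum_segments hU, Finset.sum_const, nsmul_eq_mul,
    Finset.sum_add_distrib, ← Finset.sum_div] at hsum
  have := mul_le_mul_of_nonneg_right hcard (show 0 ≤ 2 * w by linarith)
  linarith

/-- A fit without change points near a change point of the signal is bad. -/
theorem ConstOff.le_sum_signal_sub_sq {T : ℕ} {f g : ℕ → ℝ} {S : Finset ℕ} (hg : ConstOff T S g)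
    {d : ℕ} (hd : Spaced T f d) {η : ℕ} (hη : η ∈ changePoints T f) {k : ℕ} (hkd : k ≤ d)
    (hfar : ∀ s ∈ S, ¬(η < s + k ∧ s < η + k)) :
    k * jump f η ^ 2 / 2 ≤ ∑ t ∈ Finset.Ioc 0 T, (f t - g t) ^ 2 := by
  have hl := hd.le_left η hη
  have hr := hd.le_right η hη
  have hη1 := mem_changePoints.1 hη
  -- `g` keeps the value `g (η + 1)` on the `k` points on either side of `η`, while `f` takes two
  -- different values there.
  have hfl : ∀ t ∈ Finset.Ioc (η - k) η, (f t - g t) ^ 2 = (f η - g (η + 1)) ^ 2 := by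
    intro t ht
    rw [Finset.mem_Ioc] at ht
    rw [constOff_signal T f t η (by omega) (by omega) (by omega),
      hg t (η + 1) (by omega) (by omega) (by omega)]
    · exact fun s hs h => hfar s hs ⟨by omega, by omega⟩
    · intro η' hη' h
      have := hd.le_sub η' hη' η hη h.2
      omega
  have hfr : ∀ t ∈ Finset.Ioc η (η + k), (f t - g t) ^ 2 = (f (η + 1) - g (η + 1)) ^ 2 := by
    intro t ht
    rw [Finset.mem_Ioc] at ht
    rw [constOff_signal T f (η + 1) t (by omega) (by omega) (by omega),
      hg (η + 1) t (by omega) (by omega) (by omega)]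
    · exact fun s hs h => hfar s hs ⟨by omega, by omega⟩
    · intro η' hη' h
      have := hd.le_sub η hη η' hη' (by omega)
      omega
  have hsub : Finset.Ioc (η - k) (η + k) ⊆ Finset.Ioc 0 T :=
    Finset.Ioc_subset_Ioc (by omega) (by omega)
  refine le_trans ?_ (Finset.sum_le_sum_of_subset_of_nonneg hsub fun _ _ _ => sq_nonneg _)
  rw [← sum_Ioc_add (v := η) (by omega) (by omega), Finset.sum_congr rfl hfl,
    Finset.sum_congr rfl hfr, sum_Ioc_const (by omega), sum_Ioc_const (by omega),
    Nat.cast_sub (by omega), Nat.cast_add, jump_sq]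
  have := mul_sq_add_mul_sq_ge (m := k) (u := f (η + 1) - g (η + 1)) (v := f η - g (η + 1))
    le_rfl le_rfl (Nat.cast_nonneg k)
  rw [show f (η + 1) - g (η + 1) - (f η - g (η + 1)) = f (η + 1) - f η by ring] at this
  linarith

theorem sum_mul_step_sub_step {T a b : ℕ} (hab : a ≤ b) (hb : b ≤ T) (c : ℝ) (G : ℕ → ℝ) :
    ∑ t ∈ Finset.Ioc 0 T, G t * ((if a < t then c else 0) - if b < t then c else 0) =
      c * ∑ t ∈ Finset.Ioc a b, G t := by
  have hsub : Finset.Ioc a b ⊆ Finset.Ioc 0 T := Finset.Ioc_subset_Ioc (by omega) hb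
  rw [← Finset.sum_subset hsub, Finset.mul_sum]
  · refine Finset.sum_congr rfl fun t ht => ?_
    rw [Finset.mem_Ioc] at ht
    rw [if_pos (by omega), if_neg (by omega)]
    ring
  · intro t _ ht
    rw [Finset.mem_Ioc] at ht
    by_cases h : a < t
    · rw [if_pos h, if_pos (by omega)]
      ring
    · rw [if_neg h, if_neg (by omega)]
      ring

theorem sum_step_sub_step_sq {T a b : ℕ} (ha : a ≤ T) (hb : b ≤ T) (c : ℝ) :
    ∑ t ∈ Finset.Ioc 0 T, ((if a < t then c else 0) - if b < t then c else 0) ^ 2 =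
      c ^ 2 * |(b : ℝ) - a| := by
  wlog hab : a ≤ b generalizing a b
  · rw [abs_sub_comm, ← this hb ha (by omega)]
    exact Finset.sum_congr rfl fun t _ => sub_sq_comm _ _
  have : (a : ℝ) ≤ b := by exact_mod_cast hab
  simp_rw [sq ((if a < _ then c else 0) - _)]
  rw [sum_mul_step_sub_step hab hb c, abs_of_nonneg (by linarith),
    Finset.sum_congr (g := fun _ => c) rfl, sum_Ioc_const hab]
  · ring
  · intro t ht
    rw [Finset.mem_Ioc] at ht
    rw [if_pos (by omega), if_neg (by omega), sub_zero]

theorem NoiseControlled.sum_mul_step_sq_le {T : ℕ} {f x : ℕ → ℝ} {w : ℝ}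
    (hx : NoiseControlled T f x w) {a b : ℕ} (ha : a ≤ T) (hb : b ≤ T) (c : ℝ) :
    (∑ t ∈ Finset.Ioc 0 T, (x t - f t) * ((if a < t then c else 0) - if b < t then c else 0)) ^ 2 ≤
      w * (c ^ 2 * |(b : ℝ) - a|) := by
  wlog hab : a ≤ b generalizing a b
  · rw [abs_sub_comm, ← neg_sq, ← Finset.sum_neg_distrib]
    convert this hb ha (by omega) using 3 with t ht
    ring
  have hle : (a : ℝ) ≤ b := by exact_mod_cast hab
  rw [sum_mul_step_sub_step hab hb c, abs_of_nonneg (by linarith), mul_pow]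
  have := mul_le_mul_of_nonneg_left (hx a b hab hb) (sq_nonneg c)
  linarith

/-- If every change point has an estimate nearby, then the residual sum of squares is not much
larger than the sum of the squared errors. -/
theorem NoiseControlled.rss_le {T : ℕ} {f x : ℕ → ℝ} {w : ℝ} (hx : NoiseControlled T f x w)
    (hw : 0 ≤ w) {S : Finset ℕ} (hS : S ⊆ Finset.Ioo 0 T)
    (hclose : ∀ η ∈ changePoints T f, ∃ s ∈ S, jump f η ^ 2 * |(s : ℝ) - η| ≤ 24 * w) :
    rss T x S ≤ ∑ t ∈ Finset.Ioc 0 T, (x t - f t) ^ 2 +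
      (24 * ((changePoints T f).card : ℝ) ^ 2 + 10 * (changePoints T f).card) * w := by
  choose! e heS he using hclose
  set u : ℕ → ℕ → ℝ := fun η t =>
    (if η < t then f (η + 1) - f η else 0) - if e η < t then f (η + 1) - f η else 0 with hu
  -- The competitor moves each jump of `f` from `η` to its estimate `e η`. Then `f - g` is the sum
  -- of the `u η`, each supported between `η` and `e η`.
  set g : ℕ → ℝ := fun t =>
    f 1 + ∑ η ∈ changePoints T f, if e η < t then f (η + 1) - f η else 0 with hg
  have hgS : ConstOff T S g := by
    intro t t' _ htt' _ h
    simp only [hg, add_right_inj]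
    refine Finset.sum_congr rfl fun η hη => ?_
    have := h _ (heS η hη)
    by_cases hlt : e η < t
    · rw [if_pos hlt, if_pos (by omega)]
    · rw [if_neg hlt, if_neg (by omega)]
  refine (SeedBS.rss_le hS x hgS).trans ?_
  have hbound : ∀ η ∈ changePoints T f, η ≤ T ∧ e η ≤ T := fun η hη =>
    ⟨(Finset.mem_Ioo.1 (changePoints_subset T f hη)).2.le, (Finset.mem_Ioo.1 (hS (heS η hη))).2.le⟩
  have hpoint : ∀ t ∈ Finset.Ioc 0 T, (x t - g t) ^ 2 ≤ (x t - f t) ^ 2 +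
      2 * ∑ η ∈ changePoints T f, (x t - f t) * u η t +
      (changePoints T f).card * ∑ η ∈ changePoints T f, u η t ^ 2 := by
    intro t ht
    rw [Finset.mem_Ioc] at ht
    have hfg : f t - g t = ∑ η ∈ changePoints T f, u η t := by
      rw [signal_eq_sum (T := T) f (by omega) ht.2]
      simp only [hg, hu, Finset.sum_sub_distrib]
      ring
    have hcs := sq_sum_le_card_mul_sum_sq (s := changePoints T f) (f := fun η => u η t)
    rw [← Finset.mul_sum, ← hfg]
    rw [← hfg] at hcs
    nlinarith
  refine (Finset.sum_le_sum hpoint).trans ?_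
  rw [Finset.sum_add_distrib, Finset.sum_add_distrib, ← Finset.mul_sum, ← Finset.mul_sum,
    Finset.sum_comm, Finset.sum_comm (f := fun t η => u η t ^ 2)]
  have h1 : ∑ η ∈ changePoints T f, ∑ t ∈ Finset.Ioc 0 T, (x t - f t) * u η t ≤
      (changePoints T f).card * (5 * w) := by
    rw [← nsmul_eq_mul]
    refine Finset.sum_le_card_nsmul _ _ _ fun η hη => ?_
    have h := hx.sum_mul_step_sq_le (hbound η hη).1 (hbound η hη).2 (f (η + 1) - f η)
    rw [← jump_sq] at h
    have h' := mul_le_mul_of_nonneg_left (he η hη) hw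
    -- Here 24w² ≤ (5w)².
    exact (abs_le_of_sq_le_sq' (h.trans (h'.trans (by nlinarith))) (by linarith)).2
  have h2 : ∑ η ∈ changePoints T f, ∑ t ∈ Finset.Ioc 0 T, u η t ^ 2 ≤
      (changePoints T f).card * (24 * w) := by
    rw [← nsmul_eq_mul]
    refine Finset.sum_le_card_nsmul _ _ _ fun η hη => ?_
    rw [hu, sum_step_sub_step_sq (hbound η hη).1 (hbound η hη).2, ← jump_sq]
    exact he η hη
  have h3 := mul_le_mul_of_nonneg_left h2 (Nat.cast_nonneg (α := ℝ) (changePoints T f).card)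
  linarith

/-! ### The information criterion -/

/-- Up to the noise level, the error in the location of the change points. -/
noncomputable def locationError (N w : ℝ) : ℝ := (24 * N ^ 2 + 14 * N + 2) * w

/-- A set of candidates that is preferred by the information criterion to a set with at most as many
elements as there are change points, and with an estimate close to each of them, has the right
number of elements, and one of them close to each change point. -/
theorem card_eq_and_close_of_sSIC_le {T : ℕ} {f x : ℕ → ℝ} {w γ θ : ℝ}
    (hx : NoiseControlled T f x w) (hw : 0 < w) {d : ℕ} (hd : Spaced T f d) {S S' : Finset ℕ}
    (hS : S ⊆ Finset.Ioo 0 T) (hS' : S' ⊆ Finset.Ioo 0 T)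
    (hcard : S'.card ≤ (changePoints T f).card)
    (hclose : ∀ η ∈ changePoints T f, ∃ s ∈ S', jump f η ^ 2 * |(s : ℝ) - η| ≤ 24 * w)
    (hle : sSIC γ θ T x S ≤ sSIC γ θ T x S')
    (hpen : locationError (changePoints T f).card w + 2 * w < γ * Real.log T ^ θ)
    (hdw : ∀ η ∈ changePoints T f, 4 * (locationError (changePoints T f).card w +
      (changePoints T f).card * (γ * Real.log T ^ θ)) < jump f η ^ 2 * (d / 2 : ℕ)) :
    S.card = (changePoints T f).card ∧ ∀ η ∈ changePoints T f, ∃ s ∈ S,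
      2 * s < 2 * η + d ∧ 2 * η < 2 * s + d ∧
      jump f η ^ 2 * |(s : ℝ) - η| ≤ 4 * locationError (changePoints T f).card w := by
  obtain ⟨g, hg, hgeq⟩ := exists_rss_eq hS x
  have hlow := hx.le_sum_sub_sq_of_constOff hw.le hS hg
  have hup := hx.rss_le hw.le hS' hclose
  rw [← hgeq] at hlow
  rw [sSIC, sSIC] at hle
  have hN0 : (0 : ℝ) ≤ (changePoints T f).card := Nat.cast_nonneg _
  have hcard' : (S'.card : ℝ) ≤ (changePoints T f).card := by exact_mod_cast hcard
  set N : ℝ := ((changePoints T f).card : ℝ) with hN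
  set pen : ℝ := γ * Real.log T ^ θ with hpendef
  set Q := ∑ t ∈ Finset.Ioc 0 T, (f t - g t) ^ 2 with hQ
  have hQ0 : 0 ≤ Q := Finset.sum_nonneg fun _ _ => sq_nonneg _
  have hE0 : 0 < locationError N w := by rw [locationError]; positivity
  have hpen0 : 0 < pen := by linarith
  have hS'pen : S'.card * pen ≤ N * pen := mul_le_mul_of_nonneg_right hcard' hpen0.le
  -- Upper bound (24N² + 10N)w plus noise loss 2w(|S| + N + 1): at |S| = N this is `locationError`,
  -- and the last term accounts for |S| ≠ N.
  have hmain : Q / 2 + S.card * pen ≤ locationError N w + N * pen + 2 * w * (S.card - N) := by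
    rw [locationError]
    rw [show γ * (S.card : ℝ) * Real.log T ^ θ = S.card * pen by rw [hpendef]; ring,
      show γ * (S'.card : ℝ) * Real.log T ^ θ = S'.card * pen by rw [hpendef]; ring] at hle
    linarith
  have hSN : S.card ≤ (changePoints T f).card := by
    by_contra hlt
    have h1 : (1 : ℝ) ≤ S.card - N := by
      have : ((changePoints T f).card : ℝ) + 1 ≤ S.card := by exact_mod_cast not_le.1 hlt
      linarith
    have h2 := mul_le_mul_of_nonneg_left h1 hE0.le
    have h3 := mul_lt_mul_of_pos_left hpen (show 0 < S.card - N by linarith)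
    linarith
  have hSN' : (S.card : ℝ) ≤ N := Nat.cast_le.2 hSN
  have hQle : Q / 2 ≤ locationError N w + (N - S.card) * pen := by
    have := mul_nonneg hw.le (sub_nonneg.2 hSN')
    linarith
  -- A change point with no estimate within `k` forces Q ≥ kδ²/2, against `hQle`.
  have hnear : ∀ η ∈ changePoints T f, ∀ k : ℕ, k ≤ d →
      4 * (locationError N w + (N - S.card) * pen) < jump f η ^ 2 * k →
      ∃ s ∈ S, η < s + k ∧ s < η + k := by
    intro η hη k hk hlt
    by_contra! hfar
    have := hg.le_sum_signal_sub_sq hd hη hk fun s hs h => (hfar s hs h.1).not_gt h.2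
    linarith
  have hcoarse : ∀ η ∈ changePoints T f, ∃ s ∈ S, η < s + d / 2 ∧ s < η + d / 2 := by
    intro η hη
    refine hnear η hη (d / 2) (Nat.div_le_self _ _) ((hdw η hη).trans_le' ?_)
    have := mul_nonneg (Nat.cast_nonneg (α := ℝ) S.card) hpen0.le
    linarith
  -- Estimates closer than d/2 to change points at least d apart are distinct.
  have hNS : (changePoints T f).card ≤ S.card := by
    choose! e heS he using hcoarse
    refine Finset.card_le_card_of_injOn e (fun η hη => heS η hη) fun η hη η' hη' heq => ?_
    have h1 := he η hη
    have h2 := he η' hη'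
    rw [heq] at h1
    rcases lt_trichotomy η η' with h | h | h
    · have := hd.le_sub η hη η' hη' h; omega
    · exact h
    · have := hd.le_sub η' hη' η hη h; omega
  have heq : S.card = (changePoints T f).card := le_antisymm hSN hNS
  refine ⟨heq, fun η hη => ?_⟩
  have hJ : 0 < jump f η ^ 2 := by
    refine (sq_nonneg _).lt_of_ne fun h0 => ?_
    have := hdw η hη
    rw [← h0, zero_mul] at this
    have := mul_nonneg hN0 hpen0.le
    linarith
  have hcoarse' : 4 * locationError N w / jump f η ^ 2 < (d / 2 : ℕ) := by
    rw [div_lt_iff₀ hJ]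
    have := hdw η hη
    have := mul_nonneg hN0 hpen0.le
    linarith
  set k := ⌊4 * locationError N w / jump f η ^ 2⌋₊ with hk
  have hkd : k < d / 2 := (Nat.floor_lt (by positivity)).2 hcoarse'
  -- Since |S| = N, the penalty drops out of the bound on Q. The radius `k + 1` exceeds the critical
  -- value, and the strict inequalities then give distance at most `k`.
  obtain ⟨s, hs, h1, h2⟩ := hnear η hη (k + 1) (by omega) (by
    rw [heq, ← hN, sub_self, zero_mul, add_zero, mul_comm (jump f η ^ 2), ← div_lt_iff₀ hJ]
    exact_mod_cast Nat.lt_floor_add_one _)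
  refine ⟨s, hs, by omega, by omega, ?_⟩
  have hk' : |(s : ℝ) - η| ≤ k := by
    rw [abs_le]
    have a : (η : ℝ) ≤ s + k := by exact_mod_cast (by omega : η ≤ s + k)
    have b : (s : ℝ) ≤ η + k := by exact_mod_cast (by omega : s ≤ η + k)
    constructor <;> linarith
  have hfl : (k : ℝ) ≤ 4 * locationError N w / jump f η ^ 2 := Nat.floor_le (by positivity)
  rw [mul_comm, ← le_div_iff₀ hJ]
  exact hk'.trans hfl

/-- Sending a change point to its nearby estimate is strictly increasing, since the distances are
below d/2; hence it is the increasing enumeration of `S`. -/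
theorem orderEmbOfFin_close {T : ℕ} {f : ℕ → ℝ} {d : ℕ} (hd : Spaced T f d) {S : Finset ℕ}
    {B : ℝ} (hN : S.card = (changePoints T f).card)
    (h : ∀ η ∈ changePoints T f, ∃ s ∈ S, 2 * s < 2 * η + d ∧ 2 * η < 2 * s + d ∧
      jump f η ^ 2 * |(s : ℝ) - η| ≤ B) (i : Fin (changePoints T f).card) :
    jump f ((changePoints T f).orderEmbOfFin rfl i) ^ 2 *
      |(S.orderEmbOfFin hN i : ℝ) - ((changePoints T f).orderEmbOfFin rfl i : ℝ)| ≤ B := by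
  choose! e heS he1 he2 he using h
  have hmem := fun i => (changePoints T f).orderEmbOfFin_mem rfl i
  have hmono : StrictMono fun i => e ((changePoints T f).orderEmbOfFin rfl i) := by
    intro i j hij
    have hlt : (changePoints T f).orderEmbOfFin rfl i < (changePoints T f).orderEmbOfFin rfl j :=
      ((changePoints T f).orderEmbOfFin rfl).strictMono hij
    have a := hd.le_sub _ (hmem i) _ (hmem j) hlt
    have b := he1 _ (hmem i)
    have c := he2 _ (hmem j)
    simp only
    omega
  have heq := Finset.orderEmbOfFin_unique hN (fun i => heS _ (hmem i)) hmono
  rw [← congrFun heq i]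
  exact he _ (hmem i)

/-! ### Seeded intervals -/

theorem layerLength_le {a : ℝ} (ha0 : 0 < a) (ha1 : a < 1) (T k : ℕ) : layerLength a T k ≤ T :=
  mul_le_of_le_one_right (Nat.cast_nonneg T) (pow_le_one₀ ha0.le ha1.le)

theorem snd_le_of_mem_seededIntervals {a : ℝ} (ha0 : 0 < a) (ha1 : a < 1) {m T : ℕ} {I : ℕ × ℕ}
    (hI : I ∈ seededIntervals a m T) : I.2 ≤ T := by
  obtain ⟨hI, -⟩ := Finset.mem_filter.1 hI
  obtain ⟨k, -, hI⟩ := Finset.mem_biUnion.1 hI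
  obtain ⟨i, hi, rfl⟩ := Finset.mem_image.1 hI
  rw [Finset.mem_Icc] at hi
  simp only
  rw [Nat.ceil_le]
  have hl := layerLength_le ha0 ha1 T k
  -- The first interval is treated apart because a layer may consist of it alone, with shift 0/0.
  -- Otherwise the shift makes the last interval end at `T`.
  rcases hi.1.eq_or_lt with h | h
  · rw [← h]
    simpa using hl
  · have hn : (0 : ℝ) < (layerCount a k : ℝ) - 1 :=
      sub_pos.2 (by exact_mod_cast (by omega : 1 < layerCount a k))
    have hle : (i : ℝ) - 1 ≤ (layerCount a k : ℝ) - 1 := by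
      have : (i : ℝ) ≤ layerCount a k := by exact_mod_cast hi.2
      linarith
    have hs : 0 ≤ layerShift a T k := div_nonneg (sub_nonneg.2 hl) hn.le
    have := mul_le_mul_of_nonneg_right hle hs
    rw [layerShift, mul_div_cancel₀ _ hn.ne'] at this
    rw [layerShift]
    linarith

/-- Every point far from `0` and `T` is in the middle part of a seeded interval of prescribed
order of length. -/
theorem exists_mem_seededIntervals {a : ℝ} (ha0 : 0 < a) (ha1 : a < 1) {m T d η : ℕ} (hm : 2 ≤ m)
    (hmd : 8 * (m : ℝ) ≤ a * d) (hη1 : d ≤ η) (hη2 : η + d ≤ T) :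
    ∃ I ∈ seededIntervals a m T, (I.1 : ℝ) + a * d / 16 ≤ η ∧ (η : ℝ) + a * d / 16 ≤ I.2 ∧
      2 * (I.2 - I.1) ≤ d := by
  have hm' : (2 : ℝ) ≤ m := by exact_mod_cast hm
  have had : (16 : ℝ) ≤ a * d := by linarith
  have hd0 : (0 : ℝ) < d := by
    by_contra h
    have : (d : ℝ) = 0 := le_antisymm (not_lt.1 h) (Nat.cast_nonneg d)
    rw [this, mul_zero] at had
    linarith
  have hd16 : (16 : ℝ) ≤ d := had.trans (mul_le_of_le_one_left hd0.le ha1.le)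
  have cη1 : (d : ℝ) ≤ η := by exact_mod_cast hη1
  have cη2 : (η : ℝ) + d ≤ T := by exact_mod_cast hη2
  have hT0 : (0 : ℝ) < T := by linarith
  -- This picks the layer `n + 2`, whose length `l` satisfies ad/4 ≤ l < d/4. The layer is present
  -- because l > 1.
  obtain ⟨n, hn1, hn2⟩ := exists_nat_pow_near_of_lt_one (x := (d : ℝ) / (4 * T)) (y := a)
    (by positivity) ((div_le_one (by positivity)).2 (by linarith)) ha0 ha1
  have hlen : layerLength a T (n + 2) = T * a ^ (n + 1) := rfl
  set l := layerLength a T (n + 2) with hl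
  have hl1 : l < d / 4 := by
    rw [lt_div_iff₀ (by positivity)] at hn1
    rw [hlen]
    linarith
  have hl2 : a * d / 4 ≤ l := by
    rw [div_le_iff₀ (by positivity)] at hn2
    have := mul_le_mul_of_nonneg_left hn2 ha0.le
    rw [hlen, pow_succ]
    linarith
  have hl0 : 0 < l := by linarith
  have hpow : (1 / a) ^ (n + 1) = T / l := by
    rw [hlen, one_div, inv_pow]
    field_simp
  have hk : n + 2 ∈ Finset.Icc 1 ⌈Real.logb (1 / a) T⌉₊ := by
    refine Finset.mem_Icc.2 ⟨by omega, Nat.lt_ceil.2 ?_⟩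
    rw [Real.lt_logb_iff_rpow_lt (by rw [lt_div_iff₀ ha0]; linarith) hT0, Real.rpow_natCast, hpow,
      div_lt_iff₀ hl0]
    exact lt_mul_of_one_lt_right hT0 (by linarith)
  set c := ⌈(1 / a) ^ (n + 1)⌉₊ with hc
  have hcT : (T : ℝ) / l ≤ c := hpow ▸ Nat.le_ceil _
  have hTl : 1 < (T : ℝ) / l := by
    rw [lt_div_iff₀ hl0]
    linarith
  have hc1 : 1 < c := by exact_mod_cast hTl.trans_le hcT
  have hcount : layerCount a (n + 2) = 2 * c - 1 := rfl
  have hcount' : ((layerCount a (n + 2) : ℕ) : ℝ) - 1 = 2 * (c - 1) := by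
    rw [hcount, Nat.cast_sub (by omega)]
    push_cast
    ring
  have hc0 : (0 : ℝ) < c - 1 := by linarith
  set s := layerShift a T (n + 2) with hs
  have hs_eq : s = (T - l) / (2 * (c - 1)) := by rw [hs, layerShift, hcount']
  have hTl' : 0 < T - l := by linarith
  have hs0 : 0 < s := by rw [hs_eq]; positivity
  have hsl : s ≤ l / 2 := by
    rw [hs_eq, div_le_iff₀ (by positivity)]
    rw [div_le_iff₀ hl0] at hcT
    linarith
  -- The last interval starting at or before η − l/4. As s ≤ l/2, it starts after η − 3l/4 and ends
  -- after η + l/4; the margin l/4 is at least ad/16, and outward rounding only increases it.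
  set j := ⌊(η - l / 4) / s⌋₊ with hj
  have hj0 : 0 ≤ (η - l / 4) / s := div_nonneg (by linarith) hs0.le
  have hj1 : j * s ≤ η - l / 4 := by
    rw [← le_div_iff₀ hs0]
    exact Nat.floor_le hj0
  have hj2 : η - l / 4 < (j + 1) * s := by
    rw [← div_lt_iff₀ hs0]
    exact Nat.lt_floor_add_one _
  have hjn : j + 1 ∈ Finset.Icc 1 (layerCount a (n + 2)) := by
    refine Finset.mem_Icc.2 ⟨by omega, ?_⟩
    have hs_mul : s * (2 * (c - 1)) = T - l := by
      rw [hs_eq]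
      field_simp
    have : (j : ℝ) ≤ 2 * (c - 1) := by
      refine le_of_mul_le_mul_right ?_ hs0
      linarith
    have : (j : ℝ) + 1 ≤ layerCount a (n + 2) := by linarith
    exact_mod_cast this
  have hfl1 : ((⌊(j : ℝ) * s⌋₊ : ℕ) : ℝ) ≤ j * s := Nat.floor_le (by positivity)
  have hfl2 := Nat.lt_floor_add_one ((j : ℝ) * s)
  have hce1 := Nat.le_ceil ((j : ℝ) * s + l)
  have hce2 := Nat.ceil_lt_add_one (show 0 ≤ (j : ℝ) * s + l by positivity)
  have hI : (⌊(j : ℝ) * s⌋₊, ⌈(j : ℝ) * s + l⌉₊) ∈ layer a T (n + 2) :=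
    Finset.mem_image.2 ⟨j + 1, hjn, by push_cast; rw [add_sub_cancel_right]⟩
  have hle : ⌊(j : ℝ) * s⌋₊ ≤ ⌈(j : ℝ) * s + l⌉₊ := by
    have : ((⌊(j : ℝ) * s⌋₊ : ℕ) : ℝ) ≤ (⌈(j : ℝ) * s + l⌉₊ : ℕ) := by linarith
    exact_mod_cast this
  refine ⟨_, Finset.mem_filter.2 ⟨Finset.mem_biUnion.2 ⟨n + 2, hk, hI⟩, ?_⟩, ?_, ?_, ?_⟩
  · simp only
    rw [← Nat.cast_le (α := ℝ), Nat.cast_sub hle]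
    linarith
  · simp only
    linarith
  · simp only
    linarith
  · simp only
    rw [← Nat.cast_le (α := ℝ), Nat.cast_mul, Nat.cast_sub hle]
    push_cast
    linarith

/-- An interval with a single change point in the middle has a large gain. -/
theorem overThreshold_of_middle {T : ℕ} {f x : ℕ → ℝ} {w : ℝ} (hx : NoiseControlled T f x w)
    (hw : 0 ≤ w) {d : ℕ} (hd : Spaced T f d) {η : ℕ} (hη : η ∈ changePoints T f) {I : ℕ × ℕ}
    (hI : I.2 ≤ T) {b : ℝ} (hb : 0 < b) (h1 : (I.1 : ℝ) + b ≤ η) (h2 : (η : ℝ) + b ≤ I.2)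
    (hshort : 2 * (I.2 - I.1) ≤ d)
    (hbig : (5 * ((changePoints T f).card : ℝ) + 4) ^ 2 * w < jump f η ^ 2 * b / 2) :
    OverThreshold x (threshold (changePoints T f).card w) I := by
  have hη1 : I.1 < η := by
    have : (I.1 : ℝ) < η := by linarith
    exact_mod_cast this
  have hη2 : η < I.2 := by
    have : (η : ℝ) < I.2 := by linarith
    exact_mod_cast this
  have hmem : η ∈ Finset.Ioo I.1 I.2 := Finset.mem_Ioo.2 ⟨hη1, hη2⟩
  obtain ⟨s, hs, hmax⟩ := (Finset.Ioo I.1 I.2).exists_max_image (fun s => |cusum x I s|) ⟨η, hmem⟩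
  refine ⟨s, ⟨hs, hmax⟩, (hmax η hmem).trans_lt' ?_⟩
  have hleft : ∀ t ∈ Finset.Ioc I.1 η, f t = f η := by
    intro t ht
    rw [Finset.mem_Ioc] at ht
    refine constOff_signal T f t η (by omega) ht.2 (by omega) fun η' hη' h => ?_
    have := hd.le_sub η' hη' η hη h.2
    omega
  have hright : ∀ t ∈ Finset.Ioc η I.2, f t = f (η + 1) := by
    intro t ht
    rw [Finset.mem_Ioc] at ht
    refine (constOff_signal T f (η + 1) t (by omega) (by omega) (by omega) fun η' hη' h => ?_).symm
    have := hd.le_sub η hη η' hη' (by omega)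
    omega
  have hp : (0 : ℝ) < (η : ℝ) - I.1 := by linarith
  have hq : (0 : ℝ) < (I.2 : ℝ) - η := by linarith
  -- For a single jump the squared CUSUM is δ²pq/(p + q), and pq/(p + q) ≥ min(p, q)/2.
  have hcus : jump f η ^ 2 * b / 2 ≤ cusum f I η ^ 2 := by
    rw [cusum_sq_eq hη1 hη2, ← sum_Ioc_add hη1.le hη2.le, Finset.sum_congr rfl hleft,
      Finset.sum_congr rfl hright, sum_Ioc_const hη1.le, sum_Ioc_const hη2.le, jump_sq]
    set p := (η : ℝ) - I.1
    set q := (I.2 : ℝ) - η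
    rw [show (I.2 : ℝ) - I.1 = p + q by simp only [p, q]; ring,
      show (p * f η) ^ 2 / p + (q * f (η + 1)) ^ 2 / q - (p * f η + q * f (η + 1)) ^ 2 / (p + q) =
        (f (η + 1) - f η) ^ 2 * (p * q / (p + q)) by field_simp; ring, mul_div_assoc]
    refine mul_le_mul_of_nonneg_left ?_ (sq_nonneg _)
    rw [div_le_div_iff₀ two_pos (by linarith)]
    have hbp : b ≤ p := by simp only [p]; linarith
    have hbq : b ≤ q := by simp only [q]; linarith
    nlinarith [mul_le_mul_of_nonneg_right hbp hq.le, mul_le_mul_of_nonneg_right hbq hp.le]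
  -- 5N + 4 is the threshold factor 5N + 2 plus 2 for the noise.
  have hlow : (5 * ((changePoints T f).card : ℝ) + 4) * √w < |cusum f I η| := by
    refine lt_of_pow_lt_pow_left₀ 2 (abs_nonneg _) ?_
    rw [sq_abs, mul_pow, Real.sq_sqrt hw]
    linarith
  have hnoise := hx.abs_cusum_sub_le hw hI hη1 hη2
  have htri := abs_sub_abs_le_abs_sub (cusum f I η) (cusum x I η)
  rw [abs_sub_comm] at htri
  rw [threshold]
  linarith

/-! ### The deterministic part of the consistency theorem -/

/-- The path is examined only at `threshold`, as a comparison for the minimiser. `hgain` makes the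
good intervals exceed it, `hsep` puts their estimates within d/2, `hpen` excludes superfluous
estimates and `hdw` missed ones. -/
theorem IsSeedBSEstimate.consistent {a : ℝ} (ha0 : 0 < a) (ha1 : a < 1) {m : ℕ} (hm : 2 ≤ m)
    {γ θ : ℝ} {T : ℕ} {f x : ℕ → ℝ} {S : Finset ℕ} (hS : IsSeedBSEstimate a m γ θ T x S) {w : ℝ}
    (hx : NoiseControlled T f x w) (hw : 0 < w) {d : ℕ} (hd : Spaced T f d)
    (hmd : 8 * (m : ℝ) ≤ a * d)
    (hgain : ∀ η ∈ changePoints T f,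
      (5 * ((changePoints T f).card : ℝ) + 4) ^ 2 * w < jump f η ^ 2 * (a * d / 16) / 2)
    (hsep : ∀ η ∈ changePoints T f, 48 * w < jump f η ^ 2 * d)
    (hpen : locationError (changePoints T f).card w + 2 * w < γ * Real.log T ^ θ)
    (hdw : ∀ η ∈ changePoints T f, 4 * (locationError (changePoints T f).card w +
      (changePoints T f).card * (γ * Real.log T ^ θ)) < jump f η ^ 2 * (d / 2 : ℕ)) :
    ∃ hN : S.card = (changePoints T f).card, ∀ i : Fin (changePoints T f).card,
      jump f ((changePoints T f).orderEmbOfFin rfl i) ^ 2 *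
        |(S.orderEmbOfFin hN i : ℝ) - ((changePoints T f).orderEmbOfFin rfl i : ℝ)| ≤
      4 * locationError (changePoints T f).card w := by
  obtain ⟨path, hpath, κ₀, hκ₀, rfl, hmin⟩ := hS
  have hJ : ∀ I ∈ seededIntervals a m T, I.2 ≤ T := fun I hI =>
    snd_le_of_mem_seededIntervals ha0 ha1 hI
  choose! good hgood hg1 hg2 hg3 using fun η (hη : η ∈ changePoints T f) =>
    exists_mem_seededIntervals ha0 ha1 hm hmd (hd.le_left η hη) (hd.le_right η hη)
  have hm' : (2 : ℝ) ≤ m := by exact_mod_cast hm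
  have hb : 0 < a * d / 16 := by linarith
  have hκ : 0 ≤ threshold (changePoints T f).card w := by rw [threshold]; positivity
  obtain ⟨hcard, hclose⟩ := (hpath _ hκ).card_add_card_le hx hw.le hd hsep (good := good)
    (fun η hη => ⟨by
      have : ((good η).1 : ℝ) < η := by linarith [hg1 η hη]
      exact_mod_cast this, by
      have : (η : ℝ) < (good η).2 := by linarith [hg2 η hη]
      exact_mod_cast this, hg3 η hη,
      overThreshold_of_middle hx hw.le hd hη (hJ _ (hgood η hη)) hb (hg1 η hη) (hg2 η hη)
        (hg3 η hη) (hgain η hη)⟩)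
    hJ ∅ (Finset.empty_subset _) (fun η hη _ => hgood η hη) (by simp)
  obtain ⟨hN, h⟩ := card_eq_and_close_of_sSIC_le hx hw hd ((hpath _ hκ₀).subset hJ)
    ((hpath _ hκ).subset hJ) (by simpa using hcard) (fun η hη => hclose η hη (by simp))
    (hmin _ hκ) hpen hdw
  exact ⟨hN, orderEmbOfFin_close hd hN h⟩

/-! ### The noise -/

theorem hasSubgaussianMGF_of_hasLaw {Ω : Type*} [MeasurableSpace Ω] {P : Measure Ω} {Y : Ω → ℝ}
    (h : HasLaw Y (gaussianReal 0 1) P) : HasSubgaussianMGF Y 1 P := by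
  rw [← HasSubgaussianMGF.id_map_iff h.aemeasurable, h.map_eq]
  refine ⟨fun t => integrable_exp_mul_gaussianReal t, fun t => ?_⟩
  rw [mgf_id_gaussianReal]
  simp

/-- A sum of n errors is sub-Gaussian with parameter n, so at level √(wn) the tail is exp(−w/2)
whatever n is. -/
theorem IsGaussianModel.measure_sum_sq_le {Ω : Type*} [MeasurableSpace Ω] {P : Measure Ω}
    [IsProbabilityMeasure P] {T : ℕ} {f : ℕ → ℝ} {X : ℕ → Ω → ℝ} (h : IsGaussianModel P T f X)
    {w : ℝ} (hw : 0 ≤ w) {u v : ℕ} (huv : u ≤ v) (hv : v ≤ T) :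
    P {ω | w * ((v : ℝ) - u) < (∑ t ∈ Finset.Ioc u v, (X t ω - f t)) ^ 2} ≤
      ENNReal.ofReal (2 * Real.exp (-w / 2)) := by
  rcases huv.eq_or_lt with rfl | hlt
  · simp
  have hn : (0 : ℝ) < (v : ℝ) - u := sub_pos.2 (by exact_mod_cast hlt)
  have hsub : HasSubgaussianMGF
      (fun ω => ∑ t ∈ (Finset.Ioc u v).subtype (· ∈ Finset.Icc 1 T), (X t ω - f t))
      (∑ _t ∈ (Finset.Ioc u v).subtype (· ∈ Finset.Icc 1 T), 1) P :=
    HasSubgaussianMGF.sum_of_iIndepFun h.indep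
      fun t _ => hasSubgaussianMGF_of_hasLaw (h.law t t.2)
  have hmem : ∀ t ∈ Finset.Ioc u v, t ∈ Finset.Icc 1 T := by
    intro t ht
    rw [Finset.mem_Ioc] at ht
    exact Finset.mem_Icc.2 ⟨by omega, by omega⟩
  have hfun : (fun ω => ∑ t ∈ (Finset.Ioc u v).subtype (· ∈ Finset.Icc 1 T), (X t ω - f t)) =
      fun ω => ∑ t ∈ Finset.Ioc u v, (X t ω - f t) :=
    funext fun ω => Finset.sum_subtype_of_mem (fun t => X t ω - f t) hmem
  have hvar : (∑ _t ∈ (Finset.Ioc u v).subtype (· ∈ Finset.Icc 1 T), (1 : NNReal)) =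
      ((v - u : ℕ) : NNReal) := by
    rw [Finset.sum_subtype_of_mem (fun _ => (1 : NNReal)) hmem]
    simp
  rw [hfun, hvar] at hsub
  set r := √(w * ((v : ℝ) - u)) with hr
  have hr0 : 0 ≤ r := Real.sqrt_nonneg _
  have hr2 : r ^ 2 = w * ((v : ℝ) - u) := Real.sq_sqrt (by positivity)
  have hexp : Real.exp (-r ^ 2 / (2 * (((v - u : ℕ) : NNReal) : ℝ))) = Real.exp (-w / 2) := by
    rw [hr2, NNReal.coe_natCast, Nat.cast_sub huv]
    congr 1
    field_simp
  have hup := hsub.measure_ge_le (Real.sqrt_nonneg (w * ((v : ℝ) - u)))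
  have hdown := hsub.neg.measure_ge_le (Real.sqrt_nonneg (w * ((v : ℝ) - u)))
  rw [← hr, hexp] at hup hdown
  rw [← ofReal_measureReal]
  refine ENNReal.ofReal_le_ofReal ?_
  calc P.real {ω | w * ((v : ℝ) - u) < (∑ t ∈ Finset.Ioc u v, (X t ω - f t)) ^ 2}
      ≤ P.real ({ω | r ≤ ∑ t ∈ Finset.Ioc u v, (X t ω - f t)} ∪
          {ω | r ≤ (-fun ω => ∑ t ∈ Finset.Ioc u v, (X t ω - f t)) ω}) := by
        refine measureReal_mono fun ω hω => ?_
        rw [Set.mem_ofPred_eq, ← hr2] at hω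
        rcases le_abs.1 (abs_of_nonneg hr0 ▸ sq_lt_sq.1 hω).le with h | h
        · exact Or.inl h
        · exact Or.inr h
    _ ≤ Real.exp (-w / 2) + Real.exp (-w / 2) :=
        (measureReal_union_le _ _).trans (add_le_add hup hdown)
    _ = _ := by ring

theorem IsGaussianModel.measure_not_noiseControlled_le {Ω : Type*} [MeasurableSpace Ω]
    {P : Measure Ω} [IsProbabilityMeasure P] {T : ℕ} {f : ℕ → ℝ} {X : ℕ → Ω → ℝ}
    (h : IsGaussianModel P T f X) {w : ℝ} (hw : 0 ≤ w) :
    P {ω | ¬NoiseControlled T f (fun t => X t ω) w} ≤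
      ENNReal.ofReal ((T + 1) ^ 2 * (2 * Real.exp (-w / 2))) := by
  set A : Finset (ℕ × ℕ) := (Finset.range (T + 1) ×ˢ Finset.range (T + 1)).filter fun p =>
    p.1 ≤ p.2 with hA
  have hsub : {ω | ¬NoiseControlled T f (fun t => X t ω) w} ⊆ ⋃ p ∈ A,
      {ω | w * ((p.2 : ℝ) - p.1) < (∑ t ∈ Finset.Ioc p.1 p.2, (X t ω - f t)) ^ 2} := by
    intro ω hω
    rw [Set.mem_ofPred_eq, NoiseControlled] at hω
    push Not at hω
    obtain ⟨u, v, huv, hv, hlt⟩ := hω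
    refine Set.mem_biUnion (x := (u, v)) ?_ hlt
    simp only [hA, Finset.coe_filter, Finset.mem_product, Finset.mem_range, Set.mem_ofPred_eq]
    omega
  refine (measure_mono hsub).trans ((measure_biUnion_finset_le _ _).trans ?_)
  refine (Finset.sum_le_card_nsmul A _ (ENNReal.ofReal (2 * Real.exp (-w / 2)))
    fun p hp => ?_).trans ?_
  · simp only [hA, Finset.mem_filter, Finset.mem_product, Finset.mem_range] at hp
    exact h.measure_sum_sq_le hw hp.2 (by omega)
  · have hcard : (A.card : ℝ) ≤ (T + 1) ^ 2 := by
      have : A.card ≤ (T + 1) ^ 2 := (Finset.card_filter_le _ _).trans (by simp [sq])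
      exact_mod_cast this
    rw [nsmul_eq_mul, ← ENNReal.ofReal_natCast, ← ENNReal.ofReal_mul (Nat.cast_nonneg _)]
    exact ENNReal.ofReal_le_ofReal (mul_le_mul_of_nonneg_right hcard (by positivity))

/-- With w = 8 log T the tail is T⁻⁴, which beats the number (T + 1)² of intervals. -/
theorem tendsto_noise_bound :
    Tendsto (fun T : ℕ => ENNReal.ofReal (((T : ℝ) + 1) ^ 2 *
      (2 * Real.exp (-(8 * Real.log T) / 2)))) atTop (𝓝 0) := by
  rw [← ENNReal.ofReal_zero]
  refine ENNReal.tendsto_ofReal (squeeze_zero' (g := fun T : ℕ => 8 / (T : ℝ))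
    (Eventually.of_forall fun T => by positivity) ?_ (tendsto_const_div_atTop_nhds_zero_nat 8))
  filter_upwards [eventually_ge_atTop 1] with T hT
  have hT1 : (1 : ℝ) ≤ T := by exact_mod_cast hT
  have hT0 : (0 : ℝ) < T := by linarith
  have hexp : Real.exp (-(8 * Real.log T) / 2) = ((T : ℝ) ^ 4)⁻¹ := by
    rw [show -(8 * Real.log T) / 2 = -((4 : ℕ) * Real.log T) by push_cast; ring, Real.exp_neg,
      Real.exp_nat_mul, Real.exp_log hT0]
  rw [hexp, le_div_iff₀ hT0, ← mul_assoc, ← div_eq_mul_inv, div_mul_eq_mul_div,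
    div_le_iff₀ (by positivity)]
  have h1 : ((T : ℝ) + 1) ^ 2 ≤ 4 * T ^ 2 := by nlinarith
  have h2 : (T : ℝ) ^ 3 ≤ T ^ 4 := pow_le_pow_right₀ hT1 (by norm_num)
  nlinarith

theorem eventually_mul_log_rpow_lt (A : ℝ) {B p q : ℝ} (hB : 0 < B) (hpq : p < q) :
    ∀ᶠ T : ℕ in atTop, A * Real.log T ^ p < B * Real.log T ^ q := by
  have hlog : Tendsto (fun T : ℕ => Real.log T) atTop atTop :=
    Real.tendsto_log_atTop.comp tendsto_natCast_atTop_atTop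
  have hpow := (tendsto_rpow_atTop (sub_pos.2 hpq)).comp hlog
  filter_upwards [hpow.eventually_gt_atTop (A / B), hlog.eventually_gt_atTop 0] with T h1 h2
  rw [Function.comp_apply, div_lt_iff₀ hB] at h1
  have := mul_lt_mul_of_pos_right h1 (Real.rpow_pos_of_pos h2 p)
  rw [mul_right_comm, ← Real.rpow_add h2, sub_add_cancel] at this
  linarith

theorem locationError_mono {M N w : ℝ} (hM : 0 ≤ M) (hMN : M ≤ N) (hw : 0 ≤ w) :
    locationError M w ≤ locationError N w := by
  rw [locationError, locationError]
  gcongr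

end SeedBS

/-! ### Asymptotics and the choice of the constant -/

theorem theorem4 (θ₀ θ γ c₁ c₂ : ℝ) (hθ : 1 < θ) (hθθ₀ : θ < θ₀) (hγ : 0 < γ)
    (hc₁ : 0 < c₁) (hc : c₁ < c₂) :
    -- the constant depends neither on `T` and `a` nor on the minimal length `m` or the signals
    ∃ C : ℝ, ∀ (a : ℝ) (m : ℕ), a ∈ Set.Ico (1 / 2 : ℝ) 1 → 2 ≤ m →
      -- a signal `f T` for every sample size `T`
      ∀ f : ℕ → ℕ → ℝ,
        (∀ᶠ T : ℕ in atTop,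
          Real.log T ^ θ₀ ≤ (SeedBS.minSpacing T (SeedBS.changePoints T (f T)) : ℝ) ∧
          ((SeedBS.changePoints T (f T)).card : ℝ) ∈ Set.Ioo c₁ c₂ ∧
          ∀ η ∈ SeedBS.changePoints T (f T), SeedBS.jump (f T) η ∈ Set.Ioo c₁ c₂) →
      ∀ (Ω : ℕ → Type*) [∀ T, MeasurableSpace (Ω T)] (P : ∀ T, Measure (Ω T))
        [∀ T, IsProbabilityMeasure (P T)] (X : ∀ T, ℕ → Ω T → ℝ),
        (∀ T, SeedBS.IsGaussianModel (P T) T (f T) (X T)) →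
      ∀ S : ∀ T, Ω T → Finset ℕ,
        (∀ T ω, SeedBS.IsSeedBSEstimate a m γ θ T (fun t => X T t ω) (S T ω)) →
        Tendsto
          (fun T : ℕ => P T {ω |
            ∃ hN : (S T ω).card = (SeedBS.changePoints T (f T)).card,
              ∀ i : Fin (SeedBS.changePoints T (f T)).card,
                SeedBS.jump (f T) ((SeedBS.changePoints T (f T)).orderEmbOfFin rfl i) ^ 2 *
                    |((S T ω).orderEmbOfFin hN i : ℝ) -
                      ((SeedBS.changePoints T (f T)).orderEmbOfFin rfl i : ℝ)| ≤
                  C * Real.log T})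
          atTop (𝓝 1) := by
  -- `locationError` is linear in `w` and increasing in N < c₂. The values of `a` and `m` only
  -- affect how large `T` must be.
  refine ⟨4 * SeedBS.locationError c₂ 8, ?_⟩
  intro a m ha hm f hf Ω _ P _ X hX S hS
  have ha0 : 0 < a := by linarith [ha.1]
  have hlower : ∀ᶠ T : ℕ in atTop, (1 : ENNReal) - ENNReal.ofReal (((T : ℝ) + 1) ^ 2 *
      (2 * Real.exp (-(8 * Real.log T) / 2))) ≤ P T {ω |
        ∃ hN : (S T ω).card = (SeedBS.changePoints T (f T)).card,
          ∀ i : Fin (SeedBS.changePoints T (f T)).card,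
            SeedBS.jump (f T) ((SeedBS.changePoints T (f T)).orderEmbOfFin rfl i) ^ 2 *
                |((S T ω).orderEmbOfFin hN i : ℝ) -
                  ((SeedBS.changePoints T (f T)).orderEmbOfFin rfl i : ℝ)| ≤
              4 * SeedBS.locationError c₂ 8 * Real.log T} := by
    have hθ₀ : 1 < θ₀ := hθ.trans hθθ₀
    have hc₁2 : 0 < c₁ ^ 2 := by positivity
    -- The spacing exponent θ₀ beats constants, the noise level log T and the penalty exponent θ;
    -- the penalty beats the noise because θ > 1.
    filter_upwards [hf, eventually_gt_atTop 1,
      SeedBS.eventually_mul_log_rpow_lt (max (8 * m) 16) ha0 (zero_lt_one.trans hθ₀),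
      SeedBS.eventually_mul_log_rpow_lt ((5 * c₂ + 4) ^ 2 * 8)
        (show 0 < c₁ ^ 2 * (a / 32) by positivity) hθ₀,
      SeedBS.eventually_mul_log_rpow_lt (48 * 8) hc₁2 hθ₀,
      SeedBS.eventually_mul_log_rpow_lt ((24 * c₂ ^ 2 + 14 * c₂ + 4) * 8) hγ hθ,
      SeedBS.eventually_mul_log_rpow_lt (4 * ((24 * c₂ ^ 2 + 14 * c₂ + 2) * 8))
        (show 0 < c₁ ^ 2 / 8 by positivity) hθ₀,
      SeedBS.eventually_mul_log_rpow_lt (4 * (c₂ * γ))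
        (show 0 < c₁ ^ 2 / 8 by positivity) hθθ₀] with
      T ⟨hlam, hN, hjump⟩ hT e1 e2 e3 e4 e5 e6
    rw [Real.rpow_one] at e2 e3 e4 e5
    rw [Real.rpow_zero, mul_one] at e1
    have hL : 0 < Real.log T := Real.log_pos (by exact_mod_cast hT)
    set L := Real.log T with hLdef
    set N : ℝ := ((SeedBS.changePoints T (f T)).card : ℝ) with hNdef
    set d := SeedBS.minSpacing T (SeedBS.changePoints T (f T)) with hd
    have hN0 : 0 ≤ N := Nat.cast_nonneg _
    have hNc : N ≤ c₂ := hN.2.le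
    have hw : 0 < 8 * L := by positivity
    have had : max (8 * (m : ℝ)) 16 ≤ a * d :=
      e1.le.trans (mul_le_mul_of_nonneg_left hlam ha0.le)
    have hd16 : (16 : ℝ) ≤ d :=
      ((le_max_right _ _).trans had).trans (mul_le_of_le_one_left (Nat.cast_nonneg d) ha.2.le)
    have hJ : ∀ η ∈ SeedBS.changePoints T (f T), c₁ ^ 2 ≤ SeedBS.jump (f T) η ^ 2 := fun η hη =>
      pow_le_pow_left₀ hc₁.le (hjump η hη).1.le 2
    have hJd : ∀ η ∈ SeedBS.changePoints T (f T),
        c₁ ^ 2 * L ^ θ₀ ≤ SeedBS.jump (f T) η ^ 2 * d := fun η hη =>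
      mul_le_mul (hJ η hη) hlam (Real.rpow_nonneg hL.le _) (sq_nonneg _)
    have hloc := SeedBS.locationError_mono hN0 hNc hw.le
    have hpen0 : 0 ≤ γ * L ^ θ := mul_nonneg hγ.le (Real.rpow_nonneg hL.le _)
    have hgain : ∀ η ∈ SeedBS.changePoints T (f T),
        (5 * N + 4) ^ 2 * (8 * L) < SeedBS.jump (f T) η ^ 2 * (a * d / 16) / 2 := by
      intro η hη
      have h1 : (5 * N + 4) ^ 2 * (8 * L) ≤ (5 * c₂ + 4) ^ 2 * (8 * L) := by gcongr
      have h2 := mul_le_mul_of_nonneg_right (hJd η hη) (show 0 ≤ a / 32 by positivity)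
      linarith
    have hpen : SeedBS.locationError N (8 * L) + 2 * (8 * L) < γ * L ^ θ := by
      simp only [SeedBS.locationError] at hloc ⊢
      linarith
    have hdw : ∀ η ∈ SeedBS.changePoints T (f T), 4 * (SeedBS.locationError N (8 * L) +
        N * (γ * L ^ θ)) < SeedBS.jump (f T) η ^ 2 * (d / 2 : ℕ) := by
      intro η hη
      have h1 := mul_le_mul_of_nonneg_right hNc hpen0
      -- The integer half of d is bounded below by d/4. The resulting c₁²/4 is shared equally
      -- between noise and penalty, whence the two factors c₁²/8.
      have h2 : (d : ℝ) / 4 ≤ (d / 2 : ℕ) := by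
        have h16 : 16 ≤ d := by exact_mod_cast hd16
        have : d ≤ 4 * (d / 2) := by omega
        have : (d : ℝ) ≤ 4 * (d / 2 : ℕ) := by exact_mod_cast this
        linarith
      have h3 := mul_le_mul_of_nonneg_left h2 (sq_nonneg (SeedBS.jump (f T) η))
      have h4 := hJd η hη
      simp only [SeedBS.locationError] at hloc ⊢
      linarith
    -- `S` is arbitrary, so the event need not be measurable. Instead of taking complements, the
    -- whole space is covered by it and the bad noise event.
    rw [tsub_le_iff_right]
    refine le_trans ?_ (add_le_add_right ((hX T).measure_not_noiseControlled_le hw.le) _)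
    refine le_trans ?_ (measure_union_le _ _)
    rw [← measure_univ (μ := P T)]
    refine measure_mono fun ω _ => ?_
    by_cases hω : SeedBS.NoiseControlled T (f T) (fun t => X T t ω) (8 * L)
    · left
      obtain ⟨hcard, hclose⟩ := (hS T ω).consistent ha0 ha.2 hm hω hw
        (SeedBS.spaced_minSpacing T (f T)) ((le_max_left _ _).trans had) hgain
        (fun η hη => by linarith [hJd η hη]) hpen hdw
      refine ⟨hcard, fun i => (hclose i).trans ?_⟩
      simp only [SeedBS.locationError] at hloc ⊢
      linarith
    · exact Or.inr hω
  refine tendsto_of_tendsto_of_tendsto_of_le_of_le' ?_ tendsto_const_nhds hlower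
    (Eventually.of_forall fun T => prob_le_one)
  simpa using ENNReal.Tendsto.sub (tendsto_const_nhds (x := (1 : ENNReal)))
    SeedBS.tendsto_noise_bound (Or.inl ENNReal.one_ne_top)
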